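/- Let $\mathcal H$ be an infinite-dimensional complex Hilbert space (not necessarily separable), let $\mathbb T=\{z\in\mathbb C : |z|=1\}$ with Lebesgue (arc length) measure $\ell$, and let $\mu$ be a finite Borel measure on $\mathbb T$. For a unitary operator $U$ on $\mathcal H$ and $\psi\in\mathcal H$, let $\mu_\psi^U$ be the spectral measure of the pair $(U,\psi)$, i.e. the finite Borel measure on $\mathbb T$ with $\int f\,d\mu_\psi^U=\langle\psi,f(U)\psi\rangle$ for every continuous $f$ on $\mathbb T$. Put $\mathcal H_\mu(U)=\{\psi\in\mathcal H : \mu_\psi^U\ll\mu\}$, a $U$-invariant linear subspace, and let $[U]_\mu$ be the restriction of $U$ to $\mathcal H_\mu(U)$. Write $\cong$ for unitary equivalence. A unitary operator $X$ on $\mathcal H$ preserves $\mu$ on the right if $[UX]_\mu\cong[U]_\mu$ for every unitary operator $U$ on $\mathcal H$, and on the left if $[XU]_\mu\cong[U]_\mu$ for every unitary operator $U$ on $\mathcal H$. Theorem. Let $X$ be a unitary operator on $\mathcal H$. Then: (1) $X$ preserves $\mu$ on the right if and only if $X$ preserves $\mu$ on the left (in this case we say that $X$ preserves $\mu$). (2)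 If $X\neq\mathbf 1$ and $X$ preserves $\mu$, then $\mu\ll\ell$. (3) In particular, if $\mu\ne0$, $\mu\perp\ell$ and $X$ preserves $\mu$, then $X=\mathbf 1$: no nontrivial multiplicative perturbation preserves a singular spectral subspace of every unitary operator, so the Birman–Krein theorem has no nontrivial generalization to singular parts. -/

import Mathlib

open MeasureTheory
open scoped CompactlySupported InnerProductSpace

noncomputable section

/-- The unit circle `𝕋` carries its Borel σ-algebra. -/
instance Circle.instMeasurableSpaceBorel : MeasurableSpace Circle := borel Circle

instance Circle.instBorelSpaceBorel : BorelSpace Circle := ⟨rfl⟩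

/-- Lebesgue (arc length) measure on the unit circle: the image of Lebesgue measure on
`(-π, π]` under `t ↦ e^{it}`. -/
def circleLebesgue : Measure Circle :=
  Measure.map Circle.exp (volume.restrict (Set.Ioc (-Real.pi) Real.pi))

namespace UnitarySpectral

variable {H : Type*} [NormedAddCommGroup H] [InnerProductSpace ℂ H] [CompleteSpace H]

/-- The inclusion of the spectrum of a unitary operator into the unit circle. -/
def spectrumToCircle (U : unitary (H →L[ℂ] H)) :
    C(spectrum ℂ (U : H →L[ℂ] H), Circle) where
  toFun z := ⟨z.1, Unitary.spectrum_subset_circle U z.2⟩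
  continuous_toFun := by
    exact Continuous.subtype_mk continuous_subtype_val _

/-- The continuous functional calculus `g ↦ g(U)` of a unitary operator `U`, for continuous
functions `g` on the unit circle. -/
def circleCalculus (U : unitary (H →L[ℂ] H)) : C(Circle, ℂ) →⋆ₐ[ℂ] (H →L[ℂ] H) :=
  (cfcHom (R := ℂ) (a := (U : H →L[ℂ] H)) (p := IsStarNormal) inferInstance).comp
    (ContinuousMap.compStarAlgHom' ℂ ℂ (spectrumToCircle U))

/-- A real continuous function on the circle, regarded as a complex one. -/
def toComplexFun (f : C(Circle, ℝ)) : C(Circle, ℂ) where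
  toFun z := (f z : ℂ)
  continuous_toFun := by fun_prop

lemma inner_circleCalculus_of_nonneg (U : unitary (H →L[ℂ] H)) (f : C(Circle, ℝ))
    (hf : ∀ z, 0 ≤ f z) : ∃ g : C(Circle, ℂ), ∀ ψ : H,
      (⟪ψ, circleCalculus U (toComplexFun f) ψ⟫_ℂ).re = ‖circleCalculus U g ψ‖ ^ 2 := by
  let g : C(Circle, ℂ) := toComplexFun ⟨fun z => Real.sqrt (f z), by fun_prop⟩
  have hg : toComplexFun f = star g * g := by
    ext z
    simp only [toComplexFun, g, ContinuousMap.coe_mk, ContinuousMap.mul_apply,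
      ContinuousMap.star_apply, Complex.star_def, Complex.conj_ofReal]
    rw [← Complex.ofReal_mul, Real.mul_self_sqrt (hf z)]
  refine ⟨g, fun ψ => ?_⟩
  rw [hg, map_mul, map_star, ContinuousLinearMap.star_eq_adjoint,
    mul_apply_eq_comp, ContinuousLinearMap.adjoint_inner_right,
    inner_self_eq_norm_sq_to_K]
  norm_cast

/-- The positive linear functional `f ↦ ⟨ψ, f(U) ψ⟩` on the real continuous functions on the
circle. -/
def spectralFunctional (U : unitary (H →L[ℂ] H)) (ψ : H) : C_c(Circle, ℝ) →ₚ[ℝ] ℝ :=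
  PositiveLinearMap.mk₀
    { toFun := fun f => (⟪ψ, circleCalculus U (toComplexFun f) ψ⟫_ℂ).re
      map_add' := fun f g => by
        have h : toComplexFun ((f + g : C_c(Circle, ℝ)) : C(Circle, ℝ))
            = toComplexFun f + toComplexFun g := by
          ext z; simp [toComplexFun]
        rw [h, map_add, add_apply, inner_add_right, Complex.add_re]
      map_smul' := fun c f => by
        have h : toComplexFun ((c • f : C_c(Circle, ℝ)) : C(Circle, ℝ))
            = (c : ℂ) • toComplexFun f := by
          ext z; simp [toComplexFun]
        rw [h, map_smul, smul_apply, inner_smul_right]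
        simp }
    (fun f hf => by
      obtain ⟨g, hg⟩ := inner_circleCalculus_of_nonneg U f (fun z => hf z)
      change 0 ≤ (⟪ψ, circleCalculus U (toComplexFun f) ψ⟫_ℂ).re
      rw [hg ψ]
      positivity)

/-- The spectral measure `μ_ψ^U` of the pair `(U, ψ)`: the finite Borel measure on the circle
that represents `f ↦ ⟨ψ, f(U) ψ⟩`. -/
def spectralMeasure (U : unitary (H →L[ℂ] H)) (ψ : H) : Measure Circle :=
  RealRMK.rieszMeasure (spectralFunctional U ψ)

lemma integral_spectralMeasure (U : unitary (H →L[ℂ] H)) (ψ : H) (f : C_c(Circle, ℝ)) :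
    ∫ z, f z ∂(spectralMeasure U ψ) = (⟪ψ, circleCalculus U (toComplexFun f) ψ⟫_ℂ).re :=
  RealRMK.integral_rieszMeasure (spectralFunctional U ψ) f

instance (U : unitary (H →L[ℂ] H)) (ψ : H) : (spectralMeasure U ψ).Regular :=
  RealRMK.regular_rieszMeasure _

lemma spectralMeasure_eq_of_integral {U : unitary (H →L[ℂ] H)} {ψ : H} {ν : Measure Circle}
    [IsFiniteMeasure ν]
    (h : ∀ f : C(Circle, ℝ),
      (⟪ψ, circleCalculus U (toComplexFun f) ψ⟫_ℂ).re = ∫ z, f z ∂ν) :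
    spectralMeasure U ψ = ν :=
  Measure.ext_of_integral_eq_on_compactlySupported fun f => by
    rw [integral_spectralMeasure, h f]; rfl

lemma integral_spectralMeasure' (U : unitary (H →L[ℂ] H)) (ψ : H) (f : C(Circle, ℝ)) :
    ∫ z, f z ∂(spectralMeasure U ψ) = (⟪ψ, circleCalculus U (toComplexFun f) ψ⟫_ℂ).re :=
  integral_spectralMeasure U ψ ⟨f, HasCompactSupport.of_compactSpace _⟩

lemma integrable_of_finite (f : C(Circle, ℝ)) (ν : Measure Circle) [IsFiniteMeasure ν] :
    Integrable (fun z => f z) ν :=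
  f.continuous.integrable_of_hasCompactSupport (HasCompactSupport.of_compactSpace _)

lemma spectralMeasure_smul (U : unitary (H →L[ℂ] H)) (c : ℂ) (ψ : H) :
    spectralMeasure U (c • ψ) = (‖c‖₊ ^ 2) • spectralMeasure U ψ := by
  refine spectralMeasure_eq_of_integral fun f => ?_
  rw [integral_smul_nnreal_measure, integral_spectralMeasure', map_smul, inner_smul_left,
    inner_smul_right, ← mul_assoc, Complex.conj_mul', NNReal.smul_def]
  norm_cast
  rw [Complex.re_ofReal_mul]
  simp

lemma spectralMeasure_parallelogram (U : unitary (H →L[ℂ] H)) (ψ φ : H) :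
    spectralMeasure U (ψ + φ) + spectralMeasure U (ψ - φ)
      = (2 : NNReal) • (spectralMeasure U ψ + spectralMeasure U φ) := by
  refine Measure.ext_of_integral_eq_on_compactlySupported fun f => ?_
  have hi (ν : Measure Circle) [IsFiniteMeasure ν] : Integrable (fun z => f z) ν :=
    integrable_of_finite f ν
  rw [integral_smul_nnreal_measure, integral_add_measure (hi _) (hi _),
    integral_add_measure (hi _) (hi _)]
  simp only [integral_spectralMeasure, map_add, map_sub, inner_add_left, inner_add_right,
    inner_sub_left, inner_sub_right, Complex.add_re, Complex.sub_re, NNReal.smul_def, smul_eq_mul,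
    NNReal.coe_ofNat]
  ring

/-- `H_μ(U)`, the subspace of all `ψ` with `μ_ψ^U ≪ μ`. -/
def acSubspace (U : unitary (H →L[ℂ] H)) (μ : Measure Circle) : Submodule ℂ H where
  carrier := {ψ | spectralMeasure U ψ ≪ μ}
  zero_mem' := by
    have h := spectralMeasure_smul U 0 (0 : H)
    have h0 : spectralMeasure U (0 : H) = 0 := by simpa using h
    change spectralMeasure U (0 : H) ≪ μ
    rw [h0]
    exact Measure.AbsolutelyContinuous.zero μ
  add_mem' := by
    intro ψ φ hψ hφ
    have h : spectralMeasure U (ψ + φ) ≤ spectralMeasure U (ψ + φ) + spectralMeasure U (ψ - φ) :=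
      Measure.le_add_right le_rfl
    rw [spectralMeasure_parallelogram] at h
    exact h.absolutelyContinuous.trans ((hψ.add_left hφ).smul_left 2)
  smul_mem' := by
    intro c ψ hψ
    change spectralMeasure U (c • ψ) ≪ μ
    rw [spectralMeasure_smul]
    exact Measure.AbsolutelyContinuous.smul_left hψ _

lemma circleCalculus_coe (U : unitary (H →L[ℂ] H)) :
    circleCalculus U ⟨fun z => (z : ℂ), by fun_prop⟩ = (U : H →L[ℂ] H) :=
  cfcHom_id (R := ℂ) (a := (U : H →L[ℂ] H)) (p := IsStarNormal) inferInstance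

lemma spectralMeasure_apply_self (U : unitary (H →L[ℂ] H)) (ψ : H) :
    spectralMeasure U ((U : H →L[ℂ] H) ψ) = spectralMeasure U ψ := by
  refine spectralMeasure_eq_of_integral fun f => ?_
  rw [integral_spectralMeasure']
  have hc : circleCalculus U (toComplexFun f) * (U : H →L[ℂ] H)
      = (U : H →L[ℂ] H) * circleCalculus U (toComplexFun f) := by
    rw [← circleCalculus_coe U, ← map_mul, ← map_mul, mul_comm]
  have h1 : circleCalculus U (toComplexFun f) ((U : H →L[ℂ] H) ψ)
      = (U : H →L[ℂ] H) (circleCalculus U (toComplexFun f) ψ) :=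
    congrArg (fun T : H →L[ℂ] H => T ψ) hc
  have h2 : ∀ x : H, star (U : H →L[ℂ] H) ((U : H →L[ℂ] H) x) = x := fun x =>
    congrArg (fun T : H →L[ℂ] H => T x) (Unitary.coe_star_mul_self U)
  rw [h1, ← ContinuousLinearMap.adjoint_inner_right, ← ContinuousLinearMap.star_eq_adjoint, h2]

lemma apply_mem_acSubspace (U : unitary (H →L[ℂ] H)) (μ : Measure Circle) :
    ∀ ψ ∈ acSubspace U μ, (U : H →L[ℂ] H) ψ ∈ acSubspace U μ := by
  intro ψ hψ
  change spectralMeasure U ((U : H →L[ℂ] H) ψ) ≪ μ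
  rw [spectralMeasure_apply_self]
  exact hψ

/-- `[U]_μ`, the restriction of `U` to `H_μ(U)`. -/
def restrictAC (U : unitary (H →L[ℂ] H)) (μ : Measure Circle) :
    acSubspace U μ →ₗ[ℂ] acSubspace U μ :=
  ((U : H →L[ℂ] H) : H →ₗ[ℂ] H).restrict (apply_mem_acSubspace U μ)

/-- `S ≅ T`: unitary equivalence of operators on two inner product spaces. -/
def UnitarilyEquivalent {E F : Type*} [NormedAddCommGroup E] [InnerProductSpace ℂ E]
    [NormedAddCommGroup F] [InnerProductSpace ℂ F] (S : E →ₗ[ℂ] E) (T : F →ₗ[ℂ] F) : Prop :=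
  ∃ V : E ≃ₗᵢ[ℂ] F, ∀ x : E, V (S x) = T (V x)

/-- `X` preserves `μ` on the right: `[UX]_μ ≅ [U]_μ` for every unitary `U`. -/
def PreservesRight (X : unitary (H →L[ℂ] H)) (μ : Measure Circle) : Prop :=
  ∀ U : unitary (H →L[ℂ] H), UnitarilyEquivalent (restrictAC (U * X) μ) (restrictAC U μ)

/-- `X` preserves `μ` on the left: `[XU]_μ ≅ [U]_μ` for every unitary `U`. -/
def PreservesLeft (X : unitary (H →L[ℂ] H)) (μ : Measure Circle) : Prop :=
  ∀ U : unitary (H →L[ℂ] H), UnitarilyEquivalent (restrictAC (X * U) μ) (restrictAC U μ)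

end UnitarySpectral

end

/-! Left and right preservation agree because `X * U` and `U * X` are conjugate, and the conjugation
respects spectral measures (`restrictAC_mul_comm`).

For absolute continuity, suppose `μ` is not absolutely continuous. Inner regularity gives a closed
Lebesgue-null set `K` with `μ K ≠ 0`. Let `ν` be `μ` conditioned on `K`. The contradiction comes
from two unitaries with equivalent `μ`-parts, one having `ν` as a spectral measure while no spectral
measure of the other charges `K`.

If `X` is not scalar, some unit vector `e` is not an eigenvector. Put `f = X e`, and let `g` be the
normalized component of `f` orthogonal to `e`. Preservation forces the rank-one perturbations of any
`U` along `e` and along `f`, with the same phase `c`, to have equivalent `μ`-parts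
(`PreservesRight.restrictAC_conj`). Take `U` to be multiplication by the coordinate on a copy of
`L²(ν)` generated by `g`, and a scalar `d ∉ K` on the complement, which contains `e`
(`exists_unitary_model`). The perturbation along `e` does not touch the copy of `L²(ν)`, so `ν`
survives. Along `f`, spectral averaging over `c` yields Lebesgue measure, so some `c` makes the
spectral measure of `f` vanish on `K` (`exists_perturbation_null`). Since `f` together with the
`d`-eigenvectors generates everything, the perturbed operator has no spectrum in `K` at all.

If `X` is a scalar `l ≠ 1`, it rotates spectral measures by `l`, and it suffices to localize `μ` to
a small open set disjoint from its rotation. -/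

noncomputable section

namespace UnitarySpectral

/-! ### Density of trigonometric polynomials -/

/-- The coordinate function of the unit circle. -/
def circleCoord : C(Circle, ℂ) := ⟨fun z => (z : ℂ), by fun_prop⟩

@[simp] lemma circleCoord_apply (z : Circle) : circleCoord z = z := rfl

lemma circleCoord_mul_star : circleCoord * star circleCoord = 1 := by
  ext z
  simp [Complex.mul_conj]

/-- Trigonometric polynomials are dense in the continuous functions on the circle. -/
lemma eq_top_of_circleCoord_pow_mem (M : Submodule ℂ C(Circle, ℂ))
    (hM : IsClosed (M : Set C(Circle, ℂ))) (h1 : ∀ n : ℕ, circleCoord ^ n ∈ M)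
    (h2 : ∀ n : ℕ, star (circleCoord ^ n) ∈ M) : M = ⊤ := by
  let A : StarSubalgebra ℂ C(Circle, ℂ) := StarAlgebra.adjoin ℂ {circleCoord}
  have hA : A.topologicalClosure = ⊤ := by
    refine ContinuousMap.starSubalgebra_topologicalClosure_eq_top_of_separatesPoints A ?_
    intro x y hxy
    refine ⟨_, ⟨circleCoord, StarAlgebra.subset_adjoin ℂ _ rfl, rfl⟩, ?_⟩
    simpa [Circle.ext_iff] using hxy
  -- The coordinate and its conjugate are mutually inverse, so every word in them collapses to a
  -- single power of one of the two.
  have key : ∀ x ∈ Submonoid.closure (({circleCoord} : Set C(Circle, ℂ)) ∪ star {circleCoord}),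
      (∃ n : ℕ, x = circleCoord ^ n) ∨ ∃ n : ℕ, x = star (circleCoord ^ n) := by
    intro x hx
    induction hx using Submonoid.closure_induction_right with
    | one => exact Or.inl ⟨0, by simp⟩
    | mul_right x _ y hy ih =>
      have hy' : y = circleCoord ∨ y = star circleCoord := by
        rcases hy with hy | hy
        · exact Or.inl hy
        · right
          rw [← star_star y, show star y = circleCoord from hy]
      have e1 : star circleCoord * circleCoord = 1 := by rw [mul_comm, circleCoord_mul_star]
      rcases ih with ⟨n, rfl⟩ | ⟨n, rfl⟩ <;> rcases hy' with rfl | rfl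
      · exact Or.inl ⟨n + 1, by rw [pow_succ]⟩
      · rcases n with _ | n
        · exact Or.inr ⟨1, by simp⟩
        · exact Or.inl ⟨n, by rw [pow_succ, mul_assoc, circleCoord_mul_star, mul_one]⟩
      · rcases n with _ | n
        · exact Or.inl ⟨1, by simp⟩
        · exact Or.inr ⟨n, by rw [star_pow, pow_succ, mul_assoc, e1, mul_one, star_pow]⟩
      · exact Or.inr ⟨n + 1, by rw [star_pow, star_pow, pow_succ]⟩
  have hAM : (A : Set C(Circle, ℂ)) ⊆ M := by
    intro x hx
    have hx' : x ∈ Subalgebra.toSubmodule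
        (Algebra.adjoin ℂ (({circleCoord} : Set C(Circle, ℂ)) ∪ star {circleCoord})) := by
      rw [← StarAlgebra.adjoin_toSubalgebra]
      exact hx
    rw [Algebra.adjoin_eq_span] at hx'
    refine Submodule.span_le.2 (fun y hy => ?_) hx'
    rcases key y hy with ⟨n, rfl⟩ | ⟨n, rfl⟩
    · exact h1 n
    · exact h2 n
  rw [eq_top_iff]
  intro x _
  have hx : x ∈ (A.topologicalClosure : Set C(Circle, ℂ)) := by rw [hA]; trivial
  rw [StarSubalgebra.topologicalClosure_coe] at hx
  exact closure_minimal hAM hM hx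

/-! ### Spectral measures and their moments -/

variable {H : Type*} [NormedAddCommGroup H] [InnerProductSpace ℂ H] [CompleteSpace H]

instance isFiniteMeasure_spectralMeasure (U : unitary (H →L[ℂ] H)) (ψ : H) :
    IsFiniteMeasure (spectralMeasure U ψ) :=
  CompactSpace.isFiniteMeasure

lemma integrable_complex (φ : C(Circle, ℂ)) (ν : Measure Circle) [IsFiniteMeasure ν] :
    Integrable (fun z => φ z) ν :=
  φ.continuous.integrable_of_hasCompactSupport (HasCompactSupport.of_compactSpace _)

/-- Integration against a finite measure as a continuous linear functional. -/
def integralCLM (ν : Measure Circle) [IsFiniteMeasure ν] : C(Circle, ℂ) →L[ℂ] ℂ :=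
  LinearMap.mkContinuous
    { toFun := fun φ => ∫ z, φ z ∂ν
      map_add' := fun φ χ => integral_add (integrable_complex φ ν) (integrable_complex χ ν)
      map_smul' := fun c φ => integral_smul c _ }
    (ν.real Set.univ) (fun φ => by
      rw [mul_comm]
      exact norm_integral_le_of_norm_le_const (Filter.Eventually.of_forall φ.norm_coe_le_norm))

lemma integralCLM_apply (ν : Measure Circle) [IsFiniteMeasure ν] (φ : C(Circle, ℂ)) :
    integralCLM ν φ = ∫ z, φ z ∂ν := rfl

lemma integralCLM_star (ν : Measure Circle) [IsFiniteMeasure ν] (φ : C(Circle, ℂ)) :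
    integralCLM ν (star φ) = star (integralCLM ν φ) := by
  simp only [integralCLM_apply, ContinuousMap.star_apply]
  exact integral_conj

lemma integralCLM_toComplexFun (ν : Measure Circle) [IsFiniteMeasure ν] (f : C(Circle, ℝ)) :
    integralCLM ν (toComplexFun f) = ((∫ z, f z ∂ν : ℝ) : ℂ) := by
  rw [integralCLM_apply]
  exact integral_ofReal

lemma eq_toComplexFun_add (φ : C(Circle, ℂ)) :
    φ = toComplexFun ⟨fun z => (φ z).re, by fun_prop⟩
      + Complex.I • toComplexFun ⟨fun z => (φ z).im, by fun_prop⟩ := by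
  ext z
  simp [toComplexFun, mul_comm Complex.I, Complex.re_add_im]

lemma inner_circleCalculus_star (U : unitary (H →L[ℂ] H)) (ψ : H) (φ : C(Circle, ℂ)) :
    ⟪ψ, circleCalculus U (star φ) ψ⟫_ℂ = star ⟪ψ, circleCalculus U φ ψ⟫_ℂ := by
  rw [map_star, ContinuousLinearMap.star_eq_adjoint, ContinuousLinearMap.adjoint_inner_right]
  exact (inner_conj_symm _ _).symm

lemma integralCLM_spectralMeasure (U : unitary (H →L[ℂ] H)) (ψ : H) (φ : C(Circle, ℂ)) :
    integralCLM (spectralMeasure U ψ) φ = ⟪ψ, circleCalculus U φ ψ⟫_ℂ := by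
  have hr : ∀ f : C(Circle, ℝ), integralCLM (spectralMeasure U ψ) (toComplexFun f)
      = ⟪ψ, circleCalculus U (toComplexFun f) ψ⟫_ℂ := by
    intro f
    rw [integralCLM_toComplexFun, integral_spectralMeasure']
    have h : star (toComplexFun f) = toComplexFun f := by
      ext z; simp [toComplexFun]
    have h2 := inner_circleCalculus_star U ψ (toComplexFun f)
    rw [h] at h2
    exact Complex.conj_eq_iff_re.1 h2.symm
  rw [eq_toComplexFun_add φ]
  simp only [map_add, map_smul, hr, add_apply, smul_apply, inner_add_right, inner_smul_right,
    smul_eq_mul]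

lemma circleCalculus_circleCoord_pow (U : unitary (H →L[ℂ] H)) (n : ℕ) :
    circleCalculus U (circleCoord ^ n) = (U : H →L[ℂ] H) ^ n := by
  rw [map_pow]
  exact congrArg (· ^ n) (circleCalculus_coe U)

lemma integralCLM_spectralMeasure_pow (U : unitary (H →L[ℂ] H)) (ψ : H) (n : ℕ) :
    integralCLM (spectralMeasure U ψ) (circleCoord ^ n) = ⟪ψ, ((U : H →L[ℂ] H) ^ n) ψ⟫_ℂ := by
  rw [integralCLM_spectralMeasure, circleCalculus_circleCoord_pow]

/-- Moments of nonnegative order suffice: the measures are positive, so the negative moments are the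
complex conjugates. -/
lemma measure_eq_of_moments {ν ν' : Measure Circle} [IsFiniteMeasure ν] [IsFiniteMeasure ν']
    (h : ∀ n : ℕ, integralCLM ν (circleCoord ^ n) = integralCLM ν' (circleCoord ^ n)) :
    ν = ν' := by
  have hM : LinearMap.eqLocus (integralCLM ν).toLinearMap (integralCLM ν').toLinearMap = ⊤ := by
    refine eq_top_of_circleCoord_pow_mem _ ?_ (fun n => h n) fun n => ?_
    · exact isClosed_eq (integralCLM ν).continuous (integralCLM ν').continuous
    · change integralCLM ν _ = integralCLM ν' _
      rw [integralCLM_star, integralCLM_star, h]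
  refine Measure.ext_of_integral_eq_on_compactlySupported fun f => ?_
  have h1 : toComplexFun (f : C(Circle, ℝ)) ∈
      LinearMap.eqLocus (integralCLM ν).toLinearMap (integralCLM ν').toLinearMap := by
    rw [hM]; trivial
  have h2 : integralCLM ν (toComplexFun f) = integralCLM ν' (toComplexFun f) := h1
  rw [integralCLM_toComplexFun, integralCLM_toComplexFun] at h2
  exact_mod_cast h2

lemma spectralMeasure_eq_of_moments {U : unitary (H →L[ℂ] H)} {ψ : H} {ν : Measure Circle}
    [IsFiniteMeasure ν]
    (h : ∀ n : ℕ, ⟪ψ, ((U : H →L[ℂ] H) ^ n) ψ⟫_ℂ = integralCLM ν (circleCoord ^ n)) :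
    spectralMeasure U ψ = ν :=
  measure_eq_of_moments fun n => by rw [integralCLM_spectralMeasure_pow, h]

lemma spectralMeasure_eq_of_inner_eq {E : Type*} [NormedAddCommGroup E] [InnerProductSpace ℂ E]
    [CompleteSpace E] {U : unitary (H →L[ℂ] H)} {U' : unitary (E →L[ℂ] E)} {ψ : H} {φ : E}
    (h : ∀ n : ℕ, ⟪ψ, ((U : H →L[ℂ] H) ^ n) ψ⟫_ℂ = ⟪φ, ((U' : E →L[ℂ] E) ^ n) φ⟫_ℂ) :
    spectralMeasure U ψ = spectralMeasure U' φ :=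
  spectralMeasure_eq_of_moments fun n => by rw [integralCLM_spectralMeasure_pow, h]

lemma spectralMeasure_univ (U : unitary (H →L[ℂ] H)) (ψ : H) :
    (spectralMeasure U ψ).real Set.univ = ‖ψ‖ ^ 2 := by
  have h := integralCLM_spectralMeasure_pow U ψ 0
  rw [integralCLM_apply] at h
  simp only [pow_zero, ContinuousMap.one_apply, integral_const, one_apply_eq_self,
    inner_self_eq_norm_sq_to_K, Complex.real_smul, mul_one] at h
  exact Complex.ofReal_injective (by simpa using h)

lemma spectralMeasure_star_apply (U : unitary (H →L[ℂ] H)) (ψ : H) :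
    spectralMeasure U (((star U : unitary (H →L[ℂ] H)) : H →L[ℂ] H) ψ) = spectralMeasure U ψ := by
  rw [← spectralMeasure_apply_self U]
  congr 1
  exact congrArg (fun T : H →L[ℂ] H => T ψ) (Unitary.coe_mul_star_self U)

/-! ### Vectors whose spectral measure misses a set -/

/-- The vectors whose spectral measure does not charge the set `K`. -/
def nullSubspace (U : unitary (H →L[ℂ] H)) (K : Set Circle) : Submodule ℂ H where
  carrier := {ψ | spectralMeasure U ψ K = 0}
  zero_mem' := by
    have h := spectralMeasure_smul U 0 (0 : H)
    have h0 : spectralMeasure U (0 : H) = 0 := by simpa using h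
    simp [h0]
  add_mem' := by
    intro ψ φ (hψ : _ = 0) (hφ : _ = 0)
    have h := congrArg (fun m => m K) (spectralMeasure_parallelogram U ψ φ)
    simp only [Measure.add_apply, Measure.smul_apply, hψ, hφ, add_zero, smul_zero] at h
    exact (add_eq_zero.1 h).1
  smul_mem' := by
    intro c ψ (hψ : _ = 0)
    change spectralMeasure U (c • ψ) K = 0
    rw [spectralMeasure_smul, Measure.smul_apply, hψ, smul_zero]

lemma mem_nullSubspace {U : unitary (H →L[ℂ] H)} {K : Set Circle} {ψ : H} :
    ψ ∈ nullSubspace U K ↔ spectralMeasure U ψ K = 0 := Iff.rfl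

/-- The parallelogram identity for `ψ - φ` and `φ`, with `φ` null on `K`, bounds the mass of `K` for
`ψ` by twice its mass for `ψ - φ`, hence by `2 * ‖ψ - φ‖ ^ 2`. -/
lemma isClosed_nullSubspace (U : unitary (H →L[ℂ] H)) (K : Set Circle) :
    IsClosed (nullSubspace U K : Set H) := by
  refine isClosed_of_closure_subset fun ψ hψ => ?_
  rw [SetLike.mem_coe, mem_nullSubspace]
  have hle : ∀ φ ∈ nullSubspace U K, (spectralMeasure U ψ).real K ≤ 2 * ‖ψ - φ‖ ^ 2 := by
    intro φ hφ
    have h := congrArg (fun m => m.real K) (spectralMeasure_parallelogram U (ψ - φ) φ)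
    have h2 : (spectralMeasure U φ).real K = 0 := by
      rw [Measure.real, mem_nullSubspace.1 hφ, ENNReal.toReal_zero]
    simp only [sub_add_cancel] at h
    rw [measureReal_add_apply, measureReal_nnreal_smul_apply, measureReal_add_apply, h2,
      add_zero] at h
    have h3 : (spectralMeasure U (ψ - φ)).real K ≤ ‖ψ - φ‖ ^ 2 := by
      rw [← spectralMeasure_univ U]
      exact measureReal_mono (Set.subset_univ K)
    have h4 : 0 ≤ (spectralMeasure U (ψ - φ - φ)).real K := measureReal_nonneg
    norm_num at h
    linarith
  have h0 : (spectralMeasure U ψ).real K ≤ 0 := by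
    refine le_of_forall_pos_le_add fun ε hε => ?_
    obtain ⟨φ, hφ, hd⟩ := Metric.mem_closure_iff.1 hψ (Real.sqrt (ε / 2)) (by positivity)
    rw [dist_eq_norm] at hd
    have h5 : ‖ψ - φ‖ ^ 2 ≤ ε / 2 := by
      rw [← Real.sq_sqrt (by positivity : (0 : ℝ) ≤ ε / 2)]
      gcongr
    have := hle φ hφ
    linarith
  have h6 := le_antisymm h0 measureReal_nonneg
  exact (measureReal_eq_zero_iff).1 h6

lemma apply_mem_nullSubspace {U : unitary (H →L[ℂ] H)} {K : Set Circle} {ψ : H}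
    (h : ψ ∈ nullSubspace U K) : (U : H →L[ℂ] H) ψ ∈ nullSubspace U K := by
  rw [mem_nullSubspace, spectralMeasure_apply_self]
  exact h

lemma star_apply_mem_nullSubspace {U : unitary (H →L[ℂ] H)} {K : Set Circle} {ψ : H}
    (h : ψ ∈ nullSubspace U K) :
    ((star U : unitary (H →L[ℂ] H)) : H →L[ℂ] H) ψ ∈ nullSubspace U K := by
  rw [mem_nullSubspace, spectralMeasure_star_apply]
  exact h

/-- The spectral measure of an eigenvector is a multiple of the point mass at its eigenvalue. -/
lemma eigenvector_mem_nullSubspace {U : unitary (H →L[ℂ] H)} {K : Set Circle} {ψ : H}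
    {d : Circle} (hK : MeasurableSet K) (hd : d ∉ K) (h : (U : H →L[ℂ] H) ψ = (d : ℂ) • ψ) :
    ψ ∈ nullSubspace U K := by
  have hpow : ∀ n : ℕ, ((U : H →L[ℂ] H) ^ n) ψ = ((d : ℂ) ^ n) • ψ := by
    intro n
    induction n with
    | zero => simp
    | succ n ih => rw [pow_succ', mul_apply_eq_comp, ih, map_smul, h, smul_smul, pow_succ]
  have hm : spectralMeasure U ψ = (‖ψ‖₊ ^ 2) • Measure.dirac d := by
    refine spectralMeasure_eq_of_moments fun n => ?_
    rw [hpow, inner_smul_right, inner_self_eq_norm_sq_to_K, integralCLM_apply,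
      integral_smul_nnreal_measure, integral_dirac]
    simp [NNReal.smul_def, mul_comm]
  rw [mem_nullSubspace, hm, Measure.smul_apply, Measure.dirac_apply' _ hK]
  simp [hd]

/-! ### Multiplication by the coordinate on `L²(ν)` -/

lemma memLp_unimodular_mul (ν : Measure Circle) [IsFiniteMeasure ν] (w : C(Circle, ℂ))
    (hw : ∀ z, ‖w z‖ = 1) (x : Lp ℂ 2 ν) : MemLp (fun z => w z * x z) 2 ν :=
  (Lp.memLp x).of_le (w.continuous.aestronglyMeasurable.mul (Lp.aestronglyMeasurable x))
    (Filter.Eventually.of_forall fun z => by rw [norm_mul, hw, one_mul])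

/-- Multiplication by a unimodular continuous function on `L²(ν)`. -/
def unimodularMul (ν : Measure Circle) [IsFiniteMeasure ν] (w : C(Circle, ℂ))
    (hw : ∀ z, ‖w z‖ = 1) : Lp ℂ 2 ν →ₗᵢ[ℂ] Lp ℂ 2 ν :=
  have hm := memLp_unimodular_mul ν w hw
  { toFun := fun x => (hm x).toLp
    map_add' := fun x y => by
      ext1
      filter_upwards [(hm (x + y)).coeFn_toLp, (hm x).coeFn_toLp, (hm y).coeFn_toLp,
        Lp.coeFn_add x y, Lp.coeFn_add (hm x).toLp (hm y).toLp] with z h1 h2 h3 h4 h5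
      rw [h1, h5, Pi.add_apply, h2, h3, h4, Pi.add_apply, mul_add]
    map_smul' := fun c x => by
      ext1
      filter_upwards [(hm (c • x)).coeFn_toLp, (hm x).coeFn_toLp,
        Lp.coeFn_smul c x, Lp.coeFn_smul c (hm x).toLp] with z h1 h2 h3 h4
      rw [h1, RingHom.id_apply, h4, Pi.smul_apply, h2, h3, Pi.smul_apply, smul_eq_mul,
        smul_eq_mul, mul_left_comm]
    norm_map' := fun x => by
      change ‖(hm x).toLp‖ = _
      rw [Lp.norm_toLp, Lp.norm_def]
      congr 1
      refine eLpNorm_congr_norm_ae (Filter.Eventually.of_forall fun z => ?_)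
      rw [norm_mul, hw, one_mul] }

lemma coeFn_unimodularMul (ν : Measure Circle) [IsFiniteMeasure ν] (w : C(Circle, ℂ))
    (hw : ∀ z, ‖w z‖ = 1) (x : Lp ℂ 2 ν) :
    unimodularMul ν w hw x =ᵐ[ν] fun z => w z * x z :=
  MemLp.coeFn_toLp (memLp_unimodular_mul ν w hw x)

lemma unimodularMul_toLp (ν : Measure Circle) [IsFiniteMeasure ν] (w : C(Circle, ℂ))
    (hw : ∀ z, ‖w z‖ = 1) (φ : C(Circle, ℂ)) :
    unimodularMul ν w hw (ContinuousMap.toLp 2 ν ℂ φ) = ContinuousMap.toLp 2 ν ℂ (w * φ) := by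
  ext1
  filter_upwards [coeFn_unimodularMul ν w hw (ContinuousMap.toLp 2 ν ℂ φ),
    ContinuousMap.coeFn_toLp (p := 2) (𝕜 := ℂ) ν φ,
    ContinuousMap.coeFn_toLp (p := 2) (𝕜 := ℂ) ν (w * φ)] with z h1 h2 h3
  rw [h1, h2, h3, ContinuousMap.mul_apply]

lemma unimodularMul_unimodularMul (ν : Measure Circle) [IsFiniteMeasure ν] (w v : C(Circle, ℂ))
    (hw : ∀ z, ‖w z‖ = 1) (hv : ∀ z, ‖v z‖ = 1) (hvw : w * v = 1) (x : Lp ℂ 2 ν) :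
    unimodularMul ν w hw (unimodularMul ν v hv x) = x := by
  ext1
  filter_upwards [coeFn_unimodularMul ν w hw (unimodularMul ν v hv x),
    coeFn_unimodularMul ν v hv x] with z h1 h2
  rw [h1, h2, ← mul_assoc, ← ContinuousMap.mul_apply, hvw, ContinuousMap.one_apply, one_mul]

lemma norm_circleCoord (z : Circle) : ‖circleCoord z‖ = 1 :=
  Circle.norm_coe z

lemma norm_star_circleCoord (z : Circle) : ‖(star circleCoord) z‖ = 1 := by
  rw [ContinuousMap.star_apply, norm_star, norm_circleCoord]

/-- Multiplication by the coordinate on `L²(ν)`. -/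
def coordMul (ν : Measure Circle) [IsFiniteMeasure ν] : Lp ℂ 2 ν ≃ₗᵢ[ℂ] Lp ℂ 2 ν :=
  { toLinearEquiv := LinearEquiv.ofLinearMap
      (unimodularMul ν circleCoord norm_circleCoord).toLinearMap
      (unimodularMul ν (star circleCoord) norm_star_circleCoord).toLinearMap
      (LinearMap.ext fun x => unimodularMul_unimodularMul ν _ _ norm_circleCoord
        norm_star_circleCoord circleCoord_mul_star x)
      (LinearMap.ext fun x => unimodularMul_unimodularMul ν _ _ norm_star_circleCoord
        norm_circleCoord (by rw [mul_comm, circleCoord_mul_star]) x)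
    norm_map' := (unimodularMul ν circleCoord norm_circleCoord).norm_map }

lemma coordMul_toLp (ν : Measure Circle) [IsFiniteMeasure ν] (φ : C(Circle, ℂ)) :
    coordMul ν (ContinuousMap.toLp 2 ν ℂ φ) = ContinuousMap.toLp 2 ν ℂ (circleCoord * φ) :=
  unimodularMul_toLp ν _ norm_circleCoord φ

lemma coordMul_symm_toLp (ν : Measure Circle) [IsFiniteMeasure ν] (φ : C(Circle, ℂ)) :
    (coordMul ν).symm (ContinuousMap.toLp 2 ν ℂ φ)
      = ContinuousMap.toLp 2 ν ℂ (star circleCoord * φ) :=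
  unimodularMul_toLp ν _ norm_star_circleCoord φ

lemma inner_toLp (ν : Measure Circle) [IsFiniteMeasure ν] (φ χ : C(Circle, ℂ)) :
    ⟪ContinuousMap.toLp 2 ν ℂ φ, ContinuousMap.toLp 2 ν ℂ χ⟫_ℂ = integralCLM ν (star φ * χ) := by
  rw [ContinuousMap.inner_toLp, integralCLM_apply]
  simp [mul_comm]

lemma separableSpace_Lp (ν : Measure Circle) [IsFiniteMeasure ν] :
    TopologicalSpace.SeparableSpace (Lp ℂ 2 ν) :=
  (ContinuousMap.toLp_denseRange ℂ ν ℂ (p := 2) (by norm_num)).separableSpace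
    (ContinuousMap.toLp 2 ν ℂ).continuous

/-! ### Unitary operators with a prescribed spectral measure -/

lemma countable_of_orthonormal {E : Type*} [NormedAddCommGroup E] [InnerProductSpace ℂ E]
    [TopologicalSpace.SeparableSpace E] {ι : Type*} {v : ι → E} (hv : Orthonormal ℂ v) :
    Countable ι := by
  refine Pairwise.countable_of_isOpen_disjoint (s := fun i => Metric.ball (v i) (1 / 2)) ?_
    (fun i => Metric.isOpen_ball) (fun i => ⟨v i, Metric.mem_ball_self (by norm_num)⟩)
  intro i j hij
  refine Metric.ball_disjoint_ball ?_
  have h : ‖v i - v j‖ ^ 2 = 2 := by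
    rw [@norm_sub_sq ℂ, hv.1, hv.1, hv.2 hij]
    norm_num
  rw [dist_eq_norm]
  nlinarith [norm_nonneg (v i - v j)]

/-- A separable Hilbert space embeds into any infinite-dimensional one, with a prescribed image of
a unit vector and a prescribed unit vector orthogonal to the range. -/
lemma exists_linearIsometry_of_separable {E H : Type*} [NormedAddCommGroup E]
    [InnerProductSpace ℂ E] [CompleteSpace E] [TopologicalSpace.SeparableSpace E]
    [NormedAddCommGroup H] [InnerProductSpace ℂ H] [CompleteSpace H]
    (hH : ¬ FiniteDimensional ℂ H) {x₀ : E} (hx₀ : ‖x₀‖ = 1) {e g : H} (he : ‖e‖ = 1)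
    (hg : ‖g‖ = 1) (heg : ⟪e, g⟫_ℂ = 0) :
    ∃ T : E →ₗᵢ[ℂ] H, T x₀ = g ∧ ∀ x, ⟪e, T x⟫_ℂ = 0 := by
  classical
  have h1 : Orthonormal ℂ (Subtype.val : ({x₀} : Set E) → E) := by
    refine ⟨fun x => ?_, fun x y hxy => absurd (Subsingleton.elim x y) hxy⟩
    rw [x.2, hx₀]
  obtain ⟨w, b, hw, hb⟩ := h1.exists_hilbertBasis_extension
  have hne : e ≠ g := by
    rintro rfl
    rw [inner_self_eq_norm_sq_to_K, he] at heg
    norm_num at heg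
  have h2 : Orthonormal ℂ (Subtype.val : ({e, g} : Set H) → H) := by
    refine ⟨fun x => ?_, fun x y hxy => ?_⟩
    · rcases x.2 with h | h
      · rw [h, he]
      · rw [Set.mem_singleton_iff.1 h, hg]
    · obtain ⟨x, hx⟩ := x
      obtain ⟨y, hy⟩ := y
      rcases hx with rfl | rfl <;> rcases hy with rfl | rfl
      · exact absurd rfl hxy
      · exact heg
      · exact inner_eq_zero_symm.1 heg
      · exact absurd rfl hxy
  obtain ⟨w', b', hw', hb'⟩ := h2.exists_hilbertBasis_extension
  have hinf : Infinite w' := by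
    by_contra hfin
    rw [not_infinite_iff_finite] at hfin
    have := Fintype.ofFinite w'
    exact hH (Module.Finite.of_basis b'.toOrthonormalBasis.toBasis)
  have hcount : Countable w := countable_of_orthonormal b.orthonormal
  let e' : w' := ⟨e, hw' (by simp)⟩
  let g' : w' := ⟨g, hw' (by simp)⟩
  have hg'e' : g' ≠ e' := fun h => hne (congrArg Subtype.val h).symm
  have hinf' : Infinite {x : w' // x ≠ e'} :=
    (Set.Finite.infinite_compl (Set.finite_singleton e')).to_subtype
  obtain ⟨i₁, hi₁⟩ := exists_injective_nat w
  let i₂ : ℕ ↪ {x : w' // x ≠ e'} := Infinite.natEmbedding _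
  let k₀ : w := ⟨x₀, hw rfl⟩
  -- Omitting the index of `e` keeps the range of `T` orthogonal to `e`; the swap redirects the
  -- image of `x₀` to `g` without losing injectivity.
  let σ : Equiv.Perm {x : w' // x ≠ e'} := Equiv.swap (i₂ (i₁ k₀)) ⟨g', hg'e'⟩
  let j : w → w' := fun k => (σ (i₂ (i₁ k))).1
  have hj : Function.Injective j :=
    Subtype.val_injective.comp (σ.injective.comp (i₂.injective.comp hi₁))
  have hjk : j k₀ = g' := by simp [j, σ]
  have hje : ∀ k, j k ≠ e' := fun k => (σ (i₂ (i₁ k))).2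
  have hon : Orthonormal ℂ (fun k => b' (j k)) := b'.orthonormal.comp j hj
  have hof := hon.orthogonalFamily
  let T : E →ₗᵢ[ℂ] H := hof.linearIsometry.comp b.repr.toLinearIsometry
  refine ⟨T, ?_, fun x => ?_⟩
  · have hx : x₀ = b k₀ := by rw [hb]
    change hof.linearIsometry (b.repr x₀) = g
    rw [hx, b.repr_self, hof.linearIsometry_apply_single]
    simp [hjk, hb', g']
  · have hs := hof.hasSum_linearIsometry (b.repr x)
    have hs2 := hs.mapL (innerSL ℂ e)
    have hz : ∀ k, innerSL ℂ e (LinearIsometry.toSpanSingleton ℂ H (hon.1 k) (b.repr x k)) = 0 := by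
      intro k
      have he' : e = b' e' := by rw [hb']
      simp only [LinearIsometry.toSpanSingleton_apply, innerSL_apply_apply, inner_smul_right]
      rw [he', b'.orthonormal.2 (hje k).symm, mul_zero]
    have hs3 : HasSum (fun k => innerSL ℂ e
        (LinearIsometry.toSpanSingleton ℂ H (hon.1 k) (b.repr x k)))
        (innerSL ℂ e (hof.linearIsometry (b.repr x))) := hs2
    rw [funext hz] at hs3
    exact hs3.unique hasSum_zero

/-- Extension of a unitary operator on an isometrically embedded Hilbert space by a scalar. -/
lemma exists_unitary_extension {E : Type*} [NormedAddCommGroup E] [InnerProductSpace ℂ E]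
    [CompleteSpace E] (T : E →ₗᵢ[ℂ] H) (M : E ≃ₗᵢ[ℂ] E) (d : Circle) :
    ∃ U : unitary (H →L[ℂ] H), (∀ x, (U : H →L[ℂ] H) (T x) = T (M x)) ∧
      (∀ x, ((star U : unitary (H →L[ℂ] H)) : H →L[ℂ] H) (T x) = T (M.symm x)) ∧
      ∀ ψ, (∀ x, ⟪T x, ψ⟫_ℂ = 0) → (U : H →L[ℂ] H) ψ = (d : ℂ) • ψ := by
  let t : E →L[ℂ] H := T.toContinuousLinearMap
  let t' : H →L[ℂ] E := ContinuousLinearMap.adjoint t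
  have htt : ∀ x, t' (T x) = x := fun x => by
    refine ext_inner_right ℂ fun y => ?_
    rw [ContinuousLinearMap.adjoint_inner_left]
    exact T.inner_map_map x y
  -- Here `t ∘L t'` is the projection to the range of `T`: the operator is `N` transported to that
  -- range plus `c` on its complement.
  let F : (E ≃ₗᵢ[ℂ] E) → ℂ → H →L[ℂ] H := fun N c =>
    t ∘L (N : E →L[ℂ] E) ∘L t' + c • (1 - t ∘L t')
  have hF : ∀ N c x, F N c x = T (N (t' x)) + c • (x - T (t' x)) := fun N c x => rfl
  have hcomp : ∀ N N' : E ≃ₗᵢ[ℂ] E, ∀ c c' : ℂ, (∀ x, N (N' x) = x) → c * c' = 1 →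
      F N c * F N' c' = 1 := by
    intro N N' c c' hN hc
    ext x
    have h1 : t' (F N' c' x) = N' (t' x) := by
      rw [hF, map_add, map_smul, map_sub, htt, htt, sub_self, smul_zero, add_zero]
    rw [mul_apply_eq_comp, hF, h1, hN, hF, add_sub_cancel_left, smul_smul, hc, one_smul,
      one_apply_eq_self, add_sub_cancel]
  have hadj : star (F M d) = F M.symm (star (d : ℂ)) := by
    rw [ContinuousLinearMap.star_eq_adjoint, eq_comm, ContinuousLinearMap.eq_adjoint_iff]
    intro x y
    have hT : ∀ (u : E) (v : H), ⟪T u, v⟫_ℂ = ⟪u, t' v⟫_ℂ := fun u v =>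
      (ContinuousLinearMap.adjoint_inner_right t u v).symm
    have hT' : ∀ (u : E) (v : H), ⟪v, T u⟫_ℂ = ⟪t' v, u⟫_ℂ := fun u v =>
      (ContinuousLinearMap.adjoint_inner_left t u v).symm
    have hM : ⟪M.symm (t' x), t' y⟫_ℂ = ⟪t' x, M (t' y)⟫_ℂ := by
      rw [← M.inner_map_map, M.apply_symm_apply]
    rw [hF, hF]
    simp only [inner_add_left, inner_add_right, inner_smul_left, inner_smul_right, inner_sub_left,
      inner_sub_right, hT, hT', hM]
    simp
  have hd : (d : ℂ) * star (d : ℂ) = 1 := by simp [Complex.mul_conj]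
  let U : unitary (H →L[ℂ] H) := ⟨F M d, by
    rw [Unitary.mem_iff, hadj]
    exact ⟨hcomp _ _ _ _ M.symm_apply_apply (by rw [mul_comm, hd]),
      hcomp _ _ _ _ M.apply_symm_apply hd⟩⟩
  refine ⟨U, fun x => ?_, fun x => ?_, fun ψ hψ => ?_⟩
  · change F M d (T x) = _
    rw [hF, htt, sub_self, smul_zero, add_zero]
  · change star (F M d) (T x) = _
    rw [hadj, hF, htt, sub_self, smul_zero, add_zero]
  · have h0 : t' ψ = 0 := by
      refine ext_inner_left ℂ fun y => ?_
      rw [ContinuousLinearMap.adjoint_inner_right, inner_zero_right]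
      exact hψ y
    change F M d ψ = _
    rw [hF, h0]
    simp

/-- A unitary operator which is multiplication by the coordinate on a copy of `L²(ν)` and a scalar
on the orthogonal complement of that copy. -/
lemma exists_unitary_model (hH : ¬ FiniteDimensional ℂ H) (ν : Measure Circle)
    [IsProbabilityMeasure ν] {e g : H} (he : ‖e‖ = 1) (hg : ‖g‖ = 1) (heg : ⟪e, g⟫_ℂ = 0)
    (d : Circle) :
    ∃ U : unitary (H →L[ℂ] H), (U : H →L[ℂ] H) e = (d : ℂ) • e ∧
      (∀ n : ℕ, ⟪e, ((U : H →L[ℂ] H) ^ n) g⟫_ℂ = 0) ∧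
      spectralMeasure U g = ν ∧
      ∀ S : Submodule ℂ H, IsClosed (S : Set H) → (∀ x ∈ S, (U : H →L[ℂ] H) x ∈ S) →
        (∀ x ∈ S, ((star U : unitary (H →L[ℂ] H)) : H →L[ℂ] H) x ∈ S) → g ∈ S →
        (∀ x, (U : H →L[ℂ] H) x = (d : ℂ) • x → x ∈ S) → S = ⊤ := by
  have := separableSpace_Lp ν
  let ι : C(Circle, ℂ) →L[ℂ] Lp ℂ 2 ν := ContinuousMap.toLp 2 ν ℂ
  have h1 : ‖ι 1‖ = 1 := by
    have h : ⟪ι 1, ι 1⟫_ℂ = 1 := by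
      rw [inner_toLp, integralCLM_apply]
      simp
    rw [inner_self_eq_norm_sq_to_K] at h
    have h' : ‖ι 1‖ ^ 2 = 1 := Complex.ofReal_injective (by simpa using h)
    exact (pow_eq_one_iff_of_nonneg (norm_nonneg _) two_ne_zero).1 h'
  obtain ⟨T, hT1, hTe⟩ := exists_linearIsometry_of_separable hH h1 he hg heg
  obtain ⟨U, hU, hU', hUd⟩ := exists_unitary_extension T (coordMul ν) d
  have hpow : ∀ n : ℕ, ((U : H →L[ℂ] H) ^ n) g = T (ι (circleCoord ^ n)) := by
    intro n
    induction n with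
    | zero => simp [hT1]
    | succ n ih => rw [pow_succ', mul_apply_eq_comp, ih, hU, coordMul_toLp, pow_succ']
  refine ⟨U, hUd e fun x => inner_eq_zero_symm.1 (hTe x), fun n => ?_, ?_, ?_⟩
  · rw [hpow, hTe]
  · refine spectralMeasure_eq_of_moments fun n => ?_
    rw [hpow, ← hT1, T.inner_map_map, inner_toLp, star_one, one_mul]
  · intro S hS hSU hSU' hgS hSd
    have hι : S.comap (T.toLinearMap ∘ₗ ι.toLinearMap) = ⊤ := by
      refine eq_top_of_circleCoord_pow_mem _ ?_ (fun n => ?_) fun n => ?_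
      · exact hS.preimage (T.continuous.comp ι.continuous)
      · change T (ι (circleCoord ^ n)) ∈ S
        induction n with
        | zero => rw [pow_zero, hT1]; exact hgS
        | succ n ih => rw [pow_succ', ← coordMul_toLp, ← hU]; exact hSU _ ih
      · change T (ι (star (circleCoord ^ n))) ∈ S
        induction n with
        | zero => rw [pow_zero, star_one, hT1]; exact hgS
        | succ n ih =>
          rw [pow_succ, star_mul, ← coordMul_symm_toLp, ← hU']
          exact hSU' _ ih
    have hTS : ∀ x, T x ∈ S := by
      intro x
      have hx : x ∈ closure (Set.range ι) :=
        (ContinuousMap.toLp_denseRange ℂ ν ℂ (p := 2) (by norm_num)).closure_range ▸ trivial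
      refine closure_minimal (t := T ⁻¹' (S : Set H)) ?_ (hS.preimage T.continuous) hx
      rintro _ ⟨φ, rfl⟩
      have : φ ∈ S.comap (T.toLinearMap ∘ₗ ι.toLinearMap) := hι ▸ trivial
      exact this
    have hc : IsComplete (S : Set H) := hS.isComplete
    have : CompleteSpace S := hc.completeSpace_coe
    -- A vector orthogonal to `S` is orthogonal to the range of `T`, hence a `d`-eigenvector, hence
    -- itself in `S`.
    rw [← Submodule.orthogonal_eq_bot_iff, Submodule.eq_bot_iff]
    intro x hx
    have hxS : x ∈ S := hSd x (hUd x fun y => hx _ (hTS y))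
    exact inner_self_eq_zero.1 (hx x hxS)

/-! ### Rank-one perturbations and spectral averaging -/

instance isFiniteMeasure_circleLebesgue : IsFiniteMeasure circleLebesgue := by
  unfold circleLebesgue
  infer_instance

lemma circleLebesgue_ne_zero : circleLebesgue ≠ 0 := by
  intro h
  have h1 : circleLebesgue Set.univ = 0 := by rw [h]; rfl
  rw [circleLebesgue, Measure.map_apply Circle.exp.continuous.measurable MeasurableSet.univ,
    Set.preimage_univ, Measure.restrict_apply_univ, Real.volume_Ioc] at h1
  have := Real.pi_pos
  rw [ENNReal.ofReal_eq_zero] at h1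
  linarith

lemma integral_pow_circleLebesgue (k : ℕ) :
    ∫ z : Circle, (z : ℂ) ^ (k + 1) ∂circleLebesgue = 0 := by
  rw [circleLebesgue, integral_map Circle.exp.continuous.aemeasurable
    (Continuous.aestronglyMeasurable (by fun_prop)),
    ← intervalIntegral.integral_of_le (by linarith [Real.pi_pos])]
  have h : ∀ t : ℝ, ((Circle.exp t : Circle) : ℂ) ^ (k + 1)
      = Complex.exp ((((k + 1 : ℕ) : ℂ) * Complex.I) * t) := by
    intro t
    rw [Circle.coe_exp, ← Complex.exp_nat_mul]
    congr 1
    ring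
  have hc : ((k + 1 : ℕ) : ℂ) * Complex.I ≠ 0 :=
    mul_ne_zero (by exact_mod_cast k.succ_ne_zero) Complex.I_ne_zero
  simp_rw [h]
  rw [integral_exp_mul_complex hc, div_eq_zero_iff, sub_eq_zero]
  left
  rw [Complex.exp_eq_exp_iff_exists_int]
  exact ⟨k + 1, by push_cast; ring⟩

section

variable {E : Type*} [NormedAddCommGroup E] [InnerProductSpace ℂ E]

/-- The operator `1 + (c - 1) P_f`, with `P_f` the projection to the line of the unit vector `f`. -/
def lineScaling (f : E) (c : ℂ) : E →L[ℂ] E :=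
  1 + (c - 1) • (innerSL ℂ f).smulRight f

lemma lineScaling_apply (f : E) (c : ℂ) (x : E) :
    lineScaling f c x = x + (c - 1) • ⟪f, x⟫_ℂ • f := rfl

lemma lineScaling_mul {f : E} (hf : ‖f‖ = 1) {c c' : ℂ} (h : c * c' = 1) :
    lineScaling f c * lineScaling f c' = 1 := by
  ext x
  have hff : ⟪f, f⟫_ℂ = 1 := by rw [inner_self_eq_norm_sq_to_K, hf]; simp
  rw [mul_apply_eq_comp, lineScaling_apply f c, lineScaling_apply f c', one_apply_eq_self]
  simp only [inner_add_right, inner_smul_right, hff, smul_smul, add_assoc, ← add_smul]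
  rw [add_eq_left]
  convert zero_smul ℂ f
  linear_combination ⟪f, x⟫_ℂ * h

end

lemma star_lineScaling (f : H) (c : ℂ) : star (lineScaling f c) = lineScaling f (star c) := by
  rw [ContinuousLinearMap.star_eq_adjoint, eq_comm, ContinuousLinearMap.eq_adjoint_iff]
  intro x y
  simp only [lineScaling_apply, inner_add_left, inner_add_right, inner_smul_left, inner_smul_right,
    inner_conj_symm, map_sub, map_one]
  simp only [Complex.star_def, Complex.conj_conj]
  ring

/-- The unitary operator which multiplies the unit vector `f` by `c` and fixes its orthogonal
complement. -/
def lineUnitary (f : H) (hf : ‖f‖ = 1) (c : Circle) : unitary (H →L[ℂ] H) :=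
  ⟨lineScaling f c, by
    have hc : (c : ℂ) * star (c : ℂ) = 1 := by simp [Complex.mul_conj]
    rw [Unitary.mem_iff, star_lineScaling]
    exact ⟨lineScaling_mul hf (by rw [mul_comm, hc]), lineScaling_mul hf hc⟩⟩

lemma lineUnitary_apply (f : H) (hf : ‖f‖ = 1) (c : Circle) (x : H) :
    (lineUnitary f hf c : H →L[ℂ] H) x = x + ((c : ℂ) - 1) • ⟪f, x⟫_ℂ • f := rfl

lemma star_lineUnitary_apply (f : H) (hf : ‖f‖ = 1) (c : Circle) (x : H) :
    ((star (lineUnitary f hf c) : unitary (H →L[ℂ] H)) : H →L[ℂ] H) x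
      = x + (star (c : ℂ) - 1) • ⟪f, x⟫_ℂ • f := by
  change star (lineScaling f c) x = _
  rw [star_lineScaling, lineScaling_apply]

lemma integrable_of_continuous {E : Type*} [NormedAddCommGroup E] {F : Circle → E}
    (hF : Continuous F) (ν : Measure Circle) [IsFiniteMeasure ν] : Integrable F ν :=
  hF.integrable_of_hasCompactSupport (HasCompactSupport.of_compactSpace _)

/-- The positive powers of `U (1 + (c - 1) P_f)`, applied to `f`, are continuous in `c` and have no
nonpositive Fourier coefficients. -/
lemma continuous_and_integral_perturbation_pow (U : unitary (H →L[ℂ] H)) {f : H} (hf : ‖f‖ = 1)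
    (n : ℕ) :
    Continuous (fun c : Circle => (((U * lineUnitary f hf c : unitary (H →L[ℂ] H)) :
        H →L[ℂ] H) ^ (n + 1)) f) ∧
      ∀ k : ℕ, ∫ c : Circle, (c : ℂ) ^ k • (((U * lineUnitary f hf c : unitary (H →L[ℂ] H)) :
        H →L[ℂ] H) ^ (n + 1)) f ∂circleLebesgue = 0 := by
  have hff : ⟪f, f⟫_ℂ = 1 := by rw [inner_self_eq_norm_sq_to_K, hf]; simp
  have happ : ∀ (c : Circle) (x : H),
      ((U * lineUnitary f hf c : unitary (H →L[ℂ] H)) : H →L[ℂ] H) x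
        = (U : H →L[ℂ] H) (x + ((c : ℂ) - 1) • ⟪f, x⟫_ℂ • f) := fun c x => rfl
  induction n with
  | zero =>
    have h1 : ∀ c : Circle, (((U * lineUnitary f hf c : unitary (H →L[ℂ] H)) :
        H →L[ℂ] H) ^ (0 + 1)) f = (c : ℂ) • (U : H →L[ℂ] H) f := by
      intro c
      rw [zero_add, pow_one, happ, hff, one_smul, sub_smul, one_smul, add_sub_cancel, map_smul]
    simp_rw [h1]
    refine ⟨by fun_prop, fun k => ?_⟩
    simp_rw [smul_smul, ← pow_succ]
    rw [integral_smul_const, integral_pow_circleLebesgue, zero_smul]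
  | succ n ih =>
    obtain ⟨hc, hi⟩ := ih
    set F : Circle → H := fun c => (((U * lineUnitary f hf c : unitary (H →L[ℂ] H)) :
        H →L[ℂ] H) ^ (n + 1)) f with hF
    -- The perturbed operator is affine in `c`, namely `(U - B) + c B`, so the powers at `f` are
    -- polynomials in `c` divisible by `c`. The term `c B` raises the weight `k` by one, so the
    -- induction needs all `k` at once.
    let B : H →L[ℂ] H := (innerSL ℂ f).smulRight ((U : H →L[ℂ] H) f)
    have h1 : ∀ c : Circle, (((U * lineUnitary f hf c : unitary (H →L[ℂ] H)) :
        H →L[ℂ] H) ^ (n + 1 + 1)) f = ((U : H →L[ℂ] H) - B) (F c) + (c : ℂ) • B (F c) := by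
      intro c
      rw [pow_succ', mul_apply_eq_comp, happ, map_add, map_smul, map_smul]
      change _ = (U : H →L[ℂ] H) (F c) - ⟪f, F c⟫_ℂ • (U : H →L[ℂ] H) f
        + (c : ℂ) • ⟪f, F c⟫_ℂ • (U : H →L[ℂ] H) f
      rw [sub_smul, one_smul]
      abel
    simp_rw [h1]
    refine ⟨by fun_prop, fun k => ?_⟩
    have h2 : ∀ c : Circle, (c : ℂ) ^ k • (((U : H →L[ℂ] H) - B) (F c) + (c : ℂ) • B (F c))
        = ((U : H →L[ℂ] H) - B) ((c : ℂ) ^ k • F c) + B ((c : ℂ) ^ (k + 1) • F c) := by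
      intro c
      rw [smul_add, map_smul, map_smul, smul_smul, pow_succ]
    simp_rw [h2]
    have hint : ∀ m : ℕ, Integrable (fun c : Circle => (c : ℂ) ^ m • F c) circleLebesgue :=
      fun m => integrable_of_continuous (by fun_prop) _
    rw [integral_add (ContinuousLinearMap.integrable_comp _ (hint _))
      (ContinuousLinearMap.integrable_comp _ (hint _)),
      ContinuousLinearMap.integral_comp_comm _ (hint _),
      ContinuousLinearMap.integral_comp_comm _ (hint _), hi, hi, map_zero, map_zero, add_zero]

lemma norm_integralCLM_spectralMeasure_le (U : unitary (H →L[ℂ] H)) {f : H} (hf : ‖f‖ = 1)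
    (φ : C(Circle, ℂ)) : ‖integralCLM (spectralMeasure U f) φ‖ ≤ ‖φ‖ := by
  have h := norm_integral_le_of_norm_le_const (μ := spectralMeasure U f)
    (Filter.Eventually.of_forall φ.norm_coe_le_norm)
  rw [spectralMeasure_univ, hf] at h
  rwa [one_pow, mul_one] at h

/-- Continuity is clear for powers of the coordinate. It passes to uniform limits because all these
spectral measures have mass one. -/
lemma continuous_integralCLM_perturbation (U : unitary (H →L[ℂ] H)) {f : H} (hf : ‖f‖ = 1)
    (φ : C(Circle, ℂ)) :
    Continuous fun c : Circle => integralCLM (spectralMeasure (U * lineUnitary f hf c) f) φ := by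
  let M : Submodule ℂ C(Circle, ℂ) :=
    { carrier := {φ | Continuous fun c : Circle =>
        integralCLM (spectralMeasure (U * lineUnitary f hf c) f) φ}
      zero_mem' := by simpa using continuous_const
      add_mem' := fun {φ χ} hφ hχ => by
        simp only [Set.mem_ofPred_eq, map_add] at *
        exact hφ.add hχ
      smul_mem' := fun a φ hφ => by
        simp only [Set.mem_ofPred_eq, map_smul] at *
        exact hφ.const_smul a }
  have hpow : ∀ n : ℕ, circleCoord ^ n ∈ M := by
    intro n
    change Continuous fun c : Circle => _
    simp_rw [integralCLM_spectralMeasure_pow]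
    rcases n with _ | n
    · simpa using continuous_const
    · exact Continuous.inner continuous_const (continuous_and_integral_perturbation_pow U hf n).1
  have hM : M = ⊤ := by
    refine eq_top_of_circleCoord_pow_mem M ?_ hpow fun n => ?_
    · refine isClosed_of_closure_subset fun φ hφ => ?_
      refine continuous_of_uniform_approx_of_continuous fun u hu => ?_
      obtain ⟨ε, hε, hu⟩ := Metric.mem_uniformity_dist.1 hu
      obtain ⟨χ, hχ, hd⟩ := Metric.mem_closure_iff.1 hφ ε hε
      refine ⟨_, hχ, fun c => hu ?_⟩
      rw [dist_eq_norm, ← map_sub]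
      rw [dist_eq_norm] at hd
      exact (norm_integralCLM_spectralMeasure_le _ hf _).trans_lt hd
    · change Continuous fun c : Circle => _
      simp_rw [integralCLM_star]
      exact (hpow n).star
  have : φ ∈ M := hM ▸ trivial
  exact this

/-- Spectral averaging: the spectral measures of the rank-one perturbations `U (1 + (c - 1) P_f)` at
`f` average to Lebesgue measure. -/
lemma integral_integralCLM_perturbation (U : unitary (H →L[ℂ] H)) {f : H} (hf : ‖f‖ = 1)
    (φ : C(Circle, ℂ)) :
    ∫ c : Circle, integralCLM (spectralMeasure (U * lineUnitary f hf c) f) φ ∂circleLebesgue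
      = integralCLM circleLebesgue φ := by
  have hint : ∀ φ : C(Circle, ℂ), Integrable (fun c : Circle =>
      integralCLM (spectralMeasure (U * lineUnitary f hf c) f) φ) circleLebesgue := fun φ =>
    integrable_of_continuous (continuous_integralCLM_perturbation U hf φ) _
  let Λ : C(Circle, ℂ) →L[ℂ] ℂ := LinearMap.mkContinuous
    { toFun := fun φ => ∫ c : Circle,
        integralCLM (spectralMeasure (U * lineUnitary f hf c) f) φ ∂circleLebesgue
      map_add' := fun φ χ => by
        simp_rw [map_add]
        exact integral_add (hint φ) (hint χ)
      map_smul' := fun a φ => by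
        simp_rw [map_smul]
        exact integral_smul a _ }
    (circleLebesgue.real Set.univ) (fun φ => by
      rw [mul_comm]
      exact norm_integral_le_of_norm_le_const (Filter.Eventually.of_forall fun c =>
        norm_integralCLM_spectralMeasure_le _ hf φ))
  have hpow : ∀ n : ℕ, Λ (circleCoord ^ n) = integralCLM circleLebesgue (circleCoord ^ n) := by
    intro n
    change ∫ c : Circle, integralCLM (spectralMeasure (U * lineUnitary f hf c) f) _
      ∂circleLebesgue = _
    simp_rw [integralCLM_spectralMeasure_pow]
    rcases n with _ | n
    · simp [hf, integralCLM_apply]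
    · obtain ⟨hc, hi⟩ := continuous_and_integral_perturbation_pow U hf n
      have h0 := hi 0
      simp only [pow_zero, one_smul] at h0
      have h1 : integralCLM circleLebesgue (circleCoord ^ (n + 1)) = 0 :=
        integral_pow_circleLebesgue n
      rw [h1]
      have h2 := (innerSL ℂ f).integral_comp_comm (integrable_of_continuous hc circleLebesgue)
      rw [h0, map_zero] at h2
      exact h2
  have hM : LinearMap.eqLocus Λ.toLinearMap (integralCLM circleLebesgue).toLinearMap = ⊤ := by
    refine eq_top_of_circleCoord_pow_mem _ ?_ hpow fun n => ?_
    · exact isClosed_eq Λ.continuous (integralCLM circleLebesgue).continuous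
    · change Λ _ = integralCLM circleLebesgue _
      rw [integralCLM_star, ← hpow]
      change ∫ c : Circle, integralCLM (spectralMeasure (U * lineUnitary f hf c) f) _
        ∂circleLebesgue = _
      simp_rw [integralCLM_star]
      exact integral_conj
  have : φ ∈ LinearMap.eqLocus Λ.toLinearMap (integralCLM circleLebesgue).toLinearMap :=
    hM ▸ trivial
  exact this

/-- By averaging, the mass of `K` integrates over `c` to at most `circleLebesgue K = 0`, so almost
every `c` works. Closedness of `K` allows approximation of its indicator from above by continuous
functions, which gives both measurability in `c` and the bound. -/
lemma exists_perturbation_null (U : unitary (H →L[ℂ] H)) {f : H} (hf : ‖f‖ = 1)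
    {K : Set Circle} (hK : IsClosed K) (hK0 : circleLebesgue K = 0) :
    ∃ c : Circle, f ∈ nullSubspace (U * lineUnitary f hf c) K := by
  let σ : Circle → Measure Circle := fun c => spectralMeasure (U * lineUnitary f hf c) f
  have hσ : ∀ c, IsFiniteMeasure (σ c) := fun c =>
    inferInstanceAs (IsFiniteMeasure (spectralMeasure _ _))
  let r : ℕ → C(Circle, ℝ) := fun n => ⟨fun z => (hK.apprSeq n z : ℝ), by fun_prop⟩
  have hr : ∀ (n : ℕ) (ν : Measure Circle) [IsFiniteMeasure ν],
      ∫⁻ z, (hK.apprSeq n z : ENNReal) ∂ν = ENNReal.ofReal (∫ z, r n z ∂ν) := by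
    intro n ν _
    rw [ofReal_integral_eq_lintegral_ofReal (integrable_of_finite (r n) ν)
      (Filter.Eventually.of_forall fun z => NNReal.coe_nonneg _)]
    simp [r]
  have hcont : ∀ n, Continuous fun c => ∫ z, r n z ∂(σ c) := by
    intro n
    have h := Complex.continuous_re.comp
      (continuous_integralCLM_perturbation U hf (toComplexFun (r n)))
    simpa only [Function.comp_def, integralCLM_toComplexFun, Complex.ofReal_re] using h
  have havg : ∀ n, ∫ c, ∫ z, r n z ∂(σ c) ∂circleLebesgue = ∫ z, r n z ∂circleLebesgue := by
    intro n
    have h := integral_integralCLM_perturbation U hf (toComplexFun (r n))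
    simp_rw [integralCLM_toComplexFun] at h
    exact Complex.ofReal_injective (integral_ofReal.symm.trans h)
  have hlim : ∀ c, Filter.Tendsto (fun n => ∫⁻ z, (hK.apprSeq n z : ENNReal) ∂(σ c))
      Filter.atTop (nhds (σ c K)) := fun c =>
    HasOuterApproxClosed.tendsto_lintegral_apprSeq hK (σ c)
  have hmeas : Measurable fun c => σ c K := by
    refine measurable_of_tendsto_metrizable
      (f := fun n c => ∫⁻ z, (hK.apprSeq n z : ENNReal) ∂(σ c))
      (fun n => ?_) (tendsto_pi_nhds.2 hlim)
    simp_rw [hr]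
    exact (hcont n).measurable.ennreal_ofReal
  have hle : ∀ n, ∫⁻ c, σ c K ∂circleLebesgue
      ≤ ∫⁻ z, (hK.apprSeq n z : ENNReal) ∂circleLebesgue := by
    intro n
    calc ∫⁻ c, σ c K ∂circleLebesgue
        ≤ ∫⁻ c, ∫⁻ z, (hK.apprSeq n z : ENNReal) ∂(σ c) ∂circleLebesgue :=
          lintegral_mono fun c => HasOuterApproxClosed.measure_le_lintegral hK (σ c) n
      _ = ∫⁻ z, (hK.apprSeq n z : ENNReal) ∂circleLebesgue := by
          simp_rw [hr]
          rw [← ofReal_integral_eq_lintegral_ofReal (integrable_of_continuous (hcont n) _)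
            (Filter.Eventually.of_forall fun c => integral_nonneg fun z => NNReal.coe_nonneg _),
            havg]
  have h0 : ∫⁻ c, σ c K ∂circleLebesgue = 0 := by
    rw [← nonpos_iff_eq_zero, ← hK0]
    exact ge_of_tendsto' (HasOuterApproxClosed.tendsto_lintegral_apprSeq hK circleLebesgue) hle
  rw [lintegral_eq_zero_iff hmeas] at h0
  have : (ae circleLebesgue).NeBot := ae_neBot.2 circleLebesgue_ne_zero
  obtain ⟨c, hc⟩ := h0.exists
  exact ⟨c, hc⟩

/-! ### Consequences of preservation -/

lemma UnitarilyEquivalent.trans {E F G : Type*} [NormedAddCommGroup E] [InnerProductSpace ℂ E]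
    [NormedAddCommGroup F] [InnerProductSpace ℂ F] [NormedAddCommGroup G] [InnerProductSpace ℂ G]
    {R : E →ₗ[ℂ] E} {S : F →ₗ[ℂ] F} {T : G →ₗ[ℂ] G} (h : UnitarilyEquivalent R S)
    (h' : UnitarilyEquivalent S T) : UnitarilyEquivalent R T := by
  obtain ⟨V, hV⟩ := h
  obtain ⟨W, hW⟩ := h'
  exact ⟨V.trans W, fun x => by
    rw [LinearIsometryEquiv.trans_apply, LinearIsometryEquiv.trans_apply, hV, hW]⟩

lemma unitary_star_apply_apply (U : unitary (H →L[ℂ] H)) (x : H) :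
    ((star U : unitary (H →L[ℂ] H)) : H →L[ℂ] H) ((U : H →L[ℂ] H) x) = x :=
  congrArg (fun T : H →L[ℂ] H => T x) (Unitary.coe_star_mul_self U)

lemma unitary_apply_star_apply (U : unitary (H →L[ℂ] H)) (x : H) :
    (U : H →L[ℂ] H) (((star U : unitary (H →L[ℂ] H)) : H →L[ℂ] H) x) = x :=
  congrArg (fun T : H →L[ℂ] H => T x) (Unitary.coe_mul_star_self U)

lemma unitary_inner_map_map (U : unitary (H →L[ℂ] H)) (x y : H) :
    ⟪(U : H →L[ℂ] H) x, (U : H →L[ℂ] H) y⟫_ℂ = ⟪x, y⟫_ℂ :=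
  (Unitary.linearIsometryEquiv U).inner_map_map x y

lemma spectralMeasure_mul_comm (A B : unitary (H →L[ℂ] H)) (x : H) :
    spectralMeasure (B * A) ((B : H →L[ℂ] H) x) = spectralMeasure (A * B) x := by
  refine spectralMeasure_eq_of_inner_eq fun n => ?_
  have h : (((B * A : unitary (H →L[ℂ] H)) : H →L[ℂ] H) ^ n) ((B : H →L[ℂ] H) x)
      = (B : H →L[ℂ] H) ((((A * B : unitary (H →L[ℂ] H)) : H →L[ℂ] H) ^ n) x) := by
    induction n with
    | zero => rfl
    | succ n ih => rw [pow_succ', mul_apply_eq_comp, ih, pow_succ']; rfl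
  rw [h, unitary_inner_map_map]

lemma restrictAC_mul_comm (A B : unitary (H →L[ℂ] H)) (μ : Measure Circle) :
    UnitarilyEquivalent (restrictAC (A * B) μ) (restrictAC (B * A) μ) := by
  have h1 : ∀ x ∈ acSubspace (A * B) μ, (B : H →L[ℂ] H) x ∈ acSubspace (B * A) μ := by
    intro x hx
    change spectralMeasure _ _ ≪ μ
    rw [spectralMeasure_mul_comm]
    exact hx
  have h2 : ∀ x ∈ acSubspace (B * A) μ,
      ((star B : unitary (H →L[ℂ] H)) : H →L[ℂ] H) x ∈ acSubspace (A * B) μ := by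
    intro x hx
    change spectralMeasure _ _ ≪ μ
    rw [← spectralMeasure_mul_comm, unitary_apply_star_apply]
    exact hx
  let V : acSubspace (A * B) μ ≃ₗᵢ[ℂ] acSubspace (B * A) μ :=
    { toLinearEquiv := LinearEquiv.ofLinearMap
        (((B : H →L[ℂ] H) : H →ₗ[ℂ] H).restrict h1)
        ((((star B : unitary (H →L[ℂ] H)) : H →L[ℂ] H) : H →ₗ[ℂ] H).restrict h2)
        (LinearMap.ext fun x => Subtype.ext (unitary_apply_star_apply B x))
        (LinearMap.ext fun x => Subtype.ext (unitary_star_apply_apply B x))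
      norm_map' := fun x => (Unitary.linearIsometryEquiv B).norm_map x }
  exact ⟨V, fun x => Subtype.ext rfl⟩

lemma preservesRight_iff_preservesLeft (X : unitary (H →L[ℂ] H)) (μ : Measure Circle) :
    PreservesRight X μ ↔ PreservesLeft X μ :=
  ⟨fun h U => (restrictAC_mul_comm X U μ).trans (h U),
    fun h U => (restrictAC_mul_comm U X μ).trans (h U)⟩

/-- The chain is `U W' ~ U W' X = U X W ~ W U X ~ W U ~ U W`: preservation inserts and removes `X`,
and the other equivalences swap factors. -/
lemma PreservesRight.restrictAC_conj {X : unitary (H →L[ℂ] H)} {μ : Measure Circle}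
    (h : PreservesRight X μ) {W W' : unitary (H →L[ℂ] H)} (hW : W' * X = X * W)
    (U : unitary (H →L[ℂ] H)) :
    UnitarilyEquivalent (restrictAC (U * W') μ) (restrictAC (U * W) μ) := by
  have h1 : UnitarilyEquivalent (restrictAC (U * W') μ) (restrictAC (U * W' * X) μ) := by
    obtain ⟨V, hV⟩ := h (U * W')
    exact ⟨V.symm, fun x => by
      rw [LinearIsometryEquiv.symm_apply_eq, hV, LinearIsometryEquiv.apply_symm_apply]⟩
  have h2 : UnitarilyEquivalent (restrictAC (U * W' * X) μ) (restrictAC (W * U * X) μ) := by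
    rw [mul_assoc, hW, ← mul_assoc, mul_assoc W]
    exact restrictAC_mul_comm (U * X) W μ
  exact h1.trans (h2.trans ((h (W * U)).trans (restrictAC_mul_comm W U μ)))

/-- Spectral measures depend only on the inner products with powers, which the equivalence
preserves; this turns equivalence into something that can be contradicted. -/
lemma UnitarilyEquivalent.exists_spectralMeasure_eq {U U' : unitary (H →L[ℂ] H)}
    {μ : Measure Circle} (h : UnitarilyEquivalent (restrictAC U μ) (restrictAC U' μ)) {x : H}
    (hx : spectralMeasure U' x ≪ μ) : ∃ y, spectralMeasure U y = spectralMeasure U' x := by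
  obtain ⟨V, hV⟩ := h
  have hpow : ∀ (W : unitary (H →L[ℂ] H)) (n : ℕ) (z : acSubspace W μ),
      (((restrictAC W μ) ^ n) z : H) = ((W : H →L[ℂ] H) ^ n) z := by
    intro W n z
    induction n with
    | zero => rfl
    | succ n ih => rw [pow_succ', pow_succ', Module.End.mul_apply, mul_apply_eq_comp, ← ih]; rfl
  have hVn : ∀ (n : ℕ) (z : acSubspace U μ),
      V (((restrictAC U μ) ^ n) z) = ((restrictAC U' μ) ^ n) (V z) := by
    intro n z
    induction n with
    | zero => rfl
    | succ n ih =>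
      rw [pow_succ', pow_succ', Module.End.mul_apply, Module.End.mul_apply, hV, ih]
  let z : acSubspace U μ := V.symm ⟨x, hx⟩
  have hz : V z = ⟨x, hx⟩ := V.apply_symm_apply _
  refine ⟨z, spectralMeasure_eq_of_inner_eq fun n => ?_⟩
  have h1 := V.inner_map_map z (((restrictAC U μ) ^ n) z)
  rw [hVn, hz, Submodule.coe_inner, Submodule.coe_inner, hpow, hpow] at h1
  exact h1.symm

lemma lineUnitary_mul (X : unitary (H →L[ℂ] H)) {e f : H} (he : ‖e‖ = 1) (hf : ‖f‖ = 1)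
    (hXe : (X : H →L[ℂ] H) e = f) (c : Circle) :
    lineUnitary f hf c * X = X * lineUnitary e he c := by
  refine Subtype.ext (ContinuousLinearMap.ext fun x => ?_)
  change (lineUnitary f hf c : H →L[ℂ] H) ((X : H →L[ℂ] H) x)
    = (X : H →L[ℂ] H) ((lineUnitary e he c : H →L[ℂ] H) x)
  rw [lineUnitary_apply, lineUnitary_apply, map_add, map_smul, map_smul, hXe, ← hXe,
    unitary_inner_map_map]

/-! ### Nonscalar operators -/

/-- A closed subspace reducing a unitary `U'` that contains the range of `U' - U` and all
eigenvectors of `U'` for the eigenvalue `d` contains all eigenvectors of `U` for `d`. -/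
lemma eigenvector_mem_of_perturbation {U U' : unitary (H →L[ℂ] H)} {S : Submodule ℂ H}
    (hS : IsClosed (S : Set H)) (h1 : ∀ x ∈ S, (U' : H →L[ℂ] H) x ∈ S)
    (h2 : ∀ x ∈ S, ((star U' : unitary (H →L[ℂ] H)) : H →L[ℂ] H) x ∈ S) {d : ℂ}
    (hd : ∀ x, (U' : H →L[ℂ] H) x = d • x → x ∈ S)
    (hUU' : ∀ x, (U' : H →L[ℂ] H) x - (U : H →L[ℂ] H) x ∈ S) {x : H}
    (hx : (U : H →L[ℂ] H) x = d • x) : x ∈ S := by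
  have : CompleteSpace S := hS.isComplete.completeSpace_coe
  obtain ⟨s, hs, q, hq, rfl⟩ := S.exists_add_mem_mem_orthogonal x
  have hq' : (U' : H →L[ℂ] H) q ∈ Sᗮ := by
    intro y hy
    rw [← unitary_apply_star_apply U' y, unitary_inner_map_map]
    exact hq _ (h2 y hy)
  -- This vector lies in `S` because `U'` and `U` agree modulo `S`, and in `Sᗮ` because `S` reduces
  -- `U'`; hence it vanishes and `q` is a `d`-eigenvector of `U'`.
  have h3 : (U' : H →L[ℂ] H) q - d • q ∈ S := by
    have h4 := hUU' (s + q)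
    rw [hx, map_add, smul_add] at h4
    have h5 := S.sub_mem (S.add_mem h4 (S.smul_mem d hs)) (h1 s hs)
    convert h5 using 1
    abel
  have h4 : (U' : H →L[ℂ] H) q - d • q = 0 :=
    inner_self_eq_zero.1 ((Sᗮ.sub_mem hq' (Sᗮ.smul_mem d hq)) _ h3)
  exact S.add_mem hs (hd q (sub_eq_zero.1 h4))

/-- A unitary operator that is not a multiple of the identity does not preserve a measure that
charges a closed set of Lebesgue measure zero. -/
lemma not_preservesRight_of_linearIndependent (hH : ¬ FiniteDimensional ℂ H)
    (X : unitary (H →L[ℂ] H)) {v : H} (hv : LinearIndependent ℂ ![v, (X : H →L[ℂ] H) v])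
    (μ : Measure Circle) [IsFiniteMeasure μ] {K : Set Circle} (hK : IsClosed K)
    (hK0 : circleLebesgue K = 0) (hμK : μ K ≠ 0) : ¬ PreservesRight X μ := by
  intro hX
  have hv0 : v ≠ 0 := hv.ne_zero 0
  have hv1 := (LinearIndependent.pair_iff' hv0).1 hv
  obtain ⟨e, he, he'⟩ : ∃ e : H, ‖e‖ = 1 ∧ ∀ a : ℂ, (X : H →L[ℂ] H) e ≠ a • e := by
    refine ⟨((‖v‖⁻¹ : ℝ) : ℂ) • v, ?_, fun a ha => hv1 a ?_⟩
    · rw [norm_smul, Complex.norm_real, norm_inv, norm_norm,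
        inv_mul_cancel₀ (norm_ne_zero_iff.2 hv0)]
    · rw [map_smul, smul_comm] at ha
      have hc : ((‖v‖⁻¹ : ℝ) : ℂ) ≠ 0 := by
        exact_mod_cast inv_ne_zero (norm_ne_zero_iff.2 hv0)
      exact (smul_right_injective H hc ha).symm
  obtain ⟨f, hXe⟩ : ∃ f, (X : H →L[ℂ] H) e = f := ⟨_, rfl⟩
  have hf : ‖f‖ = 1 := by
    rw [← hXe, ← he]
    exact (Unitary.linearIsometryEquiv X).norm_map e
  rw [hXe] at he'
  have hg0 : f - ⟪e, f⟫_ℂ • e ≠ 0 := sub_ne_zero.2 (he' _)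
  obtain ⟨β, hβ, hβg⟩ : ∃ β : ℂ, β ≠ 0 ∧ ‖β • (f - ⟪e, f⟫_ℂ • e)‖ = 1 := by
    refine ⟨((‖f - ⟪e, f⟫_ℂ • e‖⁻¹ : ℝ) : ℂ), ?_, ?_⟩
    · exact_mod_cast inv_ne_zero (norm_ne_zero_iff.2 hg0)
    · rw [norm_smul, Complex.norm_real, norm_inv, norm_norm,
        inv_mul_cancel₀ (norm_ne_zero_iff.2 hg0)]
  have heg : ⟪e, β • (f - ⟪e, f⟫_ℂ • e)⟫_ℂ = 0 := by
    rw [inner_smul_right, inner_sub_right, inner_smul_right, inner_self_eq_norm_sq_to_K, he]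
    simp
  obtain ⟨d, hd⟩ : ∃ d, d ∉ K := by
    by_contra! h
    rw [Set.eq_univ_of_forall h, Measure.measure_univ_eq_zero] at hK0
    exact circleLebesgue_ne_zero hK0
  have hprob : IsProbabilityMeasure (ProbabilityTheory.cond μ K) :=
    ProbabilityTheory.cond_isProbabilityMeasure hμK
  obtain ⟨U, hUd, hUe, hUg, hU⟩ :=
    exists_unitary_model hH (ProbabilityTheory.cond μ K) he hβg heg d
  set g := β • (f - ⟪e, f⟫_ℂ • e) with hg
  obtain ⟨c, hc⟩ := exists_perturbation_null U hf hK hK0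
  -- The vectors `U ^ n g` are orthogonal to `e`, so the perturbation along `e` fixes them.
  have hWg : spectralMeasure (U * lineUnitary e he c) g = ProbabilityTheory.cond μ K := by
    rw [← hUg]
    refine spectralMeasure_eq_of_inner_eq fun n => ?_
    congr 1
    induction n with
    | zero => rfl
    | succ n ih =>
      rw [pow_succ', mul_apply_eq_comp, ih, pow_succ', mul_apply_eq_comp]
      change (U : H →L[ℂ] H) ((lineUnitary e he c : H →L[ℂ] H) _) = _
      rw [lineUnitary_apply, hUe, zero_smul, smul_zero, add_zero]
  obtain ⟨y, hy⟩ := (hX.restrictAC_conj (lineUnitary_mul X he hf hXe c) U).exists_spectralMeasure_eq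
    (x := g) (by rw [hWg]; exact ProbabilityTheory.cond_absolutelyContinuous)
  have happ : ∀ x, ((U * lineUnitary f hf c : unitary (H →L[ℂ] H)) : H →L[ℂ] H) x
      = (U : H →L[ℂ] H) ((lineUnitary f hf c : H →L[ℂ] H) x) := fun x => rfl
  set S := nullSubspace (U * lineUnitary f hf c) K with hS
  -- Since `f ∈ S`, the line unitary of `f` and its adjoint preserve `S`; undoing the perturbation
  -- shows that `S` reduces `U` as well.
  have hUS : ∀ x ∈ S, (U : H →L[ℂ] H) x ∈ S := by
    intro x hx
    rw [← unitary_apply_star_apply (lineUnitary f hf c) x, ← happ, star_lineUnitary_apply]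
    exact apply_mem_nullSubspace (S.add_mem hx (S.smul_mem _ (S.smul_mem _ hc)))
  have hUS' : ∀ x ∈ S, ((star U : unitary (H →L[ℂ] H)) : H →L[ℂ] H) x ∈ S := by
    intro x hx
    have h1 : ((star U : unitary (H →L[ℂ] H)) : H →L[ℂ] H) x = (lineUnitary f hf c : H →L[ℂ] H)
        (((star (U * lineUnitary f hf c) : unitary (H →L[ℂ] H)) : H →L[ℂ] H) x) := by
      rw [star_mul]
      exact (unitary_apply_star_apply _ _).symm
    rw [h1, lineUnitary_apply]
    exact S.add_mem (star_apply_mem_nullSubspace hx) (S.smul_mem _ (S.smul_mem _ hc))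
  have hdS : ∀ x, (U : H →L[ℂ] H) x = (d : ℂ) • x → x ∈ S := by
    intro x hx
    refine eigenvector_mem_of_perturbation (isClosed_nullSubspace _ K)
      (fun _ => apply_mem_nullSubspace) (fun _ => star_apply_mem_nullSubspace)
      (fun _ => eigenvector_mem_nullSubspace hK.measurableSet hd) (fun z => ?_) hx
    rw [happ, lineUnitary_apply, map_add, add_sub_cancel_left, map_smul, map_smul]
    exact S.smul_mem _ (S.smul_mem _ (hUS f hc))
  have htop : S = ⊤ := by
    refine hU S (isClosed_nullSubspace _ K) hUS hUS' ?_ hdS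
    -- `e` is a `d`-eigenvector of `U`, so `e` and `f` lie in `S`, and `g` is a combination of them.
    exact S.smul_mem _ (S.sub_mem hc (S.smul_mem _ (hdS e hUd)))
  have hyS : y ∈ S := htop ▸ trivial
  rw [hS, mem_nullSubspace, hy, hWg, ProbabilityTheory.cond_apply_self hμK (measure_ne_top μ K)]
    at hyS
  exact one_ne_zero hyS

/-! ### Scalar operators -/

lemma exists_orthonormal_pair (hH : ¬ FiniteDimensional ℂ H) :
    ∃ e g : H, ‖e‖ = 1 ∧ ‖g‖ = 1 ∧ ⟪e, g⟫_ℂ = 0 := by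
  obtain ⟨w, b, hb⟩ := exists_hilbertBasis ℂ H
  have hinf : Infinite w := by
    by_contra hfin
    rw [not_infinite_iff_finite] at hfin
    have := Fintype.ofFinite w
    exact hH (Module.Finite.of_basis b.toOrthonormalBasis.toBasis)
  obtain ⟨i, j, hij⟩ := exists_pair_ne w
  exact ⟨b i, b j, b.orthonormal.1 i, b.orthonormal.1 j, b.orthonormal.2 hij⟩

/-- A nontrivial scalar does not preserve any nonzero measure. -/
lemma not_preservesRight_of_scalar (hH : ¬ FiniteDimensional ℂ H) (X : unitary (H →L[ℂ] H))
    {l : Circle} (hl : l ≠ 1) (hX : ∀ x, (X : H →L[ℂ] H) x = (l : ℂ) • x)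
    (μ : Measure Circle) [IsFiniteMeasure μ] (hμ : μ ≠ 0) : ¬ PreservesRight X μ := by
  intro hpres
  obtain ⟨p, -, hp⟩ := exists_mem_forall_mem_nhdsWithin_pos_measure (μ := μ) (s := Set.univ)
    (by rwa [Ne, Measure.measure_univ_eq_zero])
  rw [nhdsWithin_univ] at hp
  have hne : l * p ≠ p := by simpa using hl
  obtain ⟨A, B, hA, hB, hlA, hpB, hAB⟩ := t2_separation hne
  have hm : Continuous fun z : Circle => l * z := continuous_const.mul continuous_id
  -- A neighbourhood of the support point `p` so small that rotation by `l` moves it off itself.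
  let K : Set Circle := B ∩ (fun z => l * z) ⁻¹' A
  have hKo : IsOpen K := hB.inter (hA.preimage hm)
  have hpK : p ∈ K := ⟨hpB, hlA⟩
  have hKl : ∀ z ∈ K, l * z ∉ K := fun z hz hz' => Set.disjoint_left.1 hAB hz.2 hz'.1
  have hμK : μ K ≠ 0 := (hp K (hKo.mem_nhds hpK)).ne'
  have hprob : IsProbabilityMeasure (ProbabilityTheory.cond μ K) :=
    ProbabilityTheory.cond_isProbabilityMeasure hμK
  obtain ⟨e, g, he, hg, heg⟩ := exists_orthonormal_pair hH
  obtain ⟨U, -, -, hUg, hU⟩ :=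
    exists_unitary_model hH (ProbabilityTheory.cond μ K) he hg heg p
  obtain ⟨y, hy⟩ := (hpres U).exists_spectralMeasure_eq (x := g)
    (by rw [hUg]; exact ProbabilityTheory.cond_absolutelyContinuous)
  have happ : ∀ x, ((U * X : unitary (H →L[ℂ] H)) : H →L[ℂ] H) x
      = (l : ℂ) • (U : H →L[ℂ] H) x := by
    intro x
    change (U : H →L[ℂ] H) ((X : H →L[ℂ] H) x) = _
    rw [hX, map_smul]
  have hll : star (l : ℂ) * (l : ℂ) = 1 := by rw [mul_comm]; simp [Complex.mul_conj]
  set S := nullSubspace (U * X) K with hS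
  have hgS : g ∈ S := by
    have hsm : spectralMeasure (U * X) g
        = (ProbabilityTheory.cond μ K).map (fun z => l * z) := by
      have := Measure.isFiniteMeasure_map (ProbabilityTheory.cond μ K) (fun z : Circle => l * z)
      refine spectralMeasure_eq_of_moments fun n => ?_
      have hpow : (((U * X : unitary (H →L[ℂ] H)) : H →L[ℂ] H) ^ n) g
          = (l : ℂ) ^ n • ((U : H →L[ℂ] H) ^ n) g := by
        induction n with
        | zero => simp
        | succ n ih =>
          rw [pow_succ', mul_apply_eq_comp, ih, happ, map_smul, smul_smul, pow_succ' (l : ℂ),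
            pow_succ' (U : H →L[ℂ] H), mul_apply_eq_comp]
      rw [hpow, inner_smul_right, ← integralCLM_spectralMeasure_pow, integralCLM_apply, hUg,
        integralCLM_apply, integral_map hm.aemeasurable
          (ContinuousMap.continuous _).aestronglyMeasurable, ← integral_const_mul]
      simp [mul_pow]
    rw [hS, mem_nullSubspace, hsm, Measure.map_apply hm.measurable hKo.measurableSet,
      ProbabilityTheory.cond_apply hKo.measurableSet]
    have hemp : K ∩ (fun z => l * z) ⁻¹' K = ∅ :=
      Set.eq_empty_of_forall_notMem fun z hz => hKl z hz.1 hz.2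
    rw [hemp, measure_empty, mul_zero]
  have htop : S = ⊤ := by
    refine hU S (isClosed_nullSubspace _ K) (fun x hx => ?_) (fun x hx => ?_) hgS fun x hx => ?_
    · have h1 := S.smul_mem (star (l : ℂ)) (apply_mem_nullSubspace hx)
      rwa [happ, smul_smul, hll, one_smul] at h1
    · have h1 : ((star U : unitary (H →L[ℂ] H)) : H →L[ℂ] H) x = (l : ℂ) •
          ((star (U * X) : unitary (H →L[ℂ] H)) : H →L[ℂ] H) x := by
        rw [star_mul, ← hX]
        exact (unitary_apply_star_apply X _).symm
      rw [h1]
      exact S.smul_mem _ (star_apply_mem_nullSubspace hx)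
    -- The scalar on the complement was taken to be `p`, so `U * X` has eigenvalue `l * p` there,
    -- which is outside `K`.
    · refine eigenvector_mem_nullSubspace hKo.measurableSet (hKl p hpK) ?_
      rw [happ, hx, smul_smul, Circle.coe_mul]
  have hyS : y ∈ S := htop ▸ trivial
  rw [hS, mem_nullSubspace, hy, hUg, ProbabilityTheory.cond_apply_self hμK (measure_ne_top μ K)]
    at hyS
  exact one_ne_zero hyS

/-! ### Reduction to a closed null set and conclusion -/

lemma exists_isClosed_null_of_not_absolutelyContinuous {μ : Measure Circle} [IsFiniteMeasure μ]
    (h : ¬ μ ≪ circleLebesgue) : ∃ K, IsClosed K ∧ circleLebesgue K = 0 ∧ μ K ≠ 0 := by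
  by_contra! hK
  refine h (Measure.AbsolutelyContinuous.mk fun s hs hs0 => ?_)
  by_contra hμs
  obtain ⟨K, hKs, hKc, hμK⟩ :=
    hs.exists_lt_isCompact_of_ne_top (measure_ne_top μ s) (pos_iff_ne_zero.2 hμs)
  exact hμK.ne' (hK K hKc.isClosed (measure_mono_null hKs hs0))

lemma exists_scalar_of_forall_not_linearIndependent (hH : ¬ FiniteDimensional ℂ H)
    {X : unitary (H →L[ℂ] H)} (h : ∀ v : H, ¬ LinearIndependent ℂ ![v, (X : H →L[ℂ] H) v]) :
    ∃ l : Circle, ∀ x, (X : H →L[ℂ] H) x = (l : ℂ) • x := by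
  obtain ⟨a, ha⟩ := LinearMap.exists_eq_smul_id_of_forall_notLinearIndependent
    (f := ((X : H →L[ℂ] H) : H →ₗ[ℂ] H)) h
  have ha' : ∀ x, (X : H →L[ℂ] H) x = a • x := fun x => congrArg (fun T : H →ₗ[ℂ] H => T x) ha
  obtain ⟨e, -, he, -, -⟩ := exists_orthonormal_pair hH
  have hn : ‖(X : H →L[ℂ] H) e‖ = ‖e‖ := (Unitary.linearIsometryEquiv X).norm_map e
  rw [ha', norm_smul, he, mul_one] at hn
  exact ⟨⟨a, by simpa [Submonoid.unitSphere] using hn⟩, ha'⟩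

lemma PreservesRight.absolutelyContinuous (hH : ¬ FiniteDimensional ℂ H)
    {X : unitary (H →L[ℂ] H)} {μ : Measure Circle} [IsFiniteMeasure μ] (hX1 : X ≠ 1)
    (hX : PreservesRight X μ) : μ ≪ circleLebesgue := by
  by_contra hμ
  obtain ⟨K, hK, hK0, hμK⟩ := exists_isClosed_null_of_not_absolutelyContinuous hμ
  by_cases h : ∃ v : H, LinearIndependent ℂ ![v, (X : H →L[ℂ] H) v]
  · obtain ⟨v, hv⟩ := h
    exact not_preservesRight_of_linearIndependent hH X hv μ hK hK0 hμK hX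
  · push Not at h
    obtain ⟨l, hl⟩ := exists_scalar_of_forall_not_linearIndependent hH h
    refine not_preservesRight_of_scalar hH X (fun hl1 => hX1 ?_) hl μ (fun h0 => hμK ?_) hX
    · refine Subtype.ext (ContinuousLinearMap.ext fun x => ?_)
      rw [hl, hl1, Circle.coe_one, one_smul]
      rfl
    · rw [h0]; rfl

end UnitarySpectral

end

theorem mainTheorem1 {H : Type*} [NormedAddCommGroup H] [InnerProductSpace ℂ H] [CompleteSpace H]
    (hH : ¬ FiniteDimensional ℂ H)
    (X : unitary (H →L[ℂ] H)) (μ : Measure Circle) [IsFiniteMeasure μ] :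
    (UnitarySpectral.PreservesRight X μ ↔ UnitarySpectral.PreservesLeft X μ) ∧
    (X ≠ 1 → UnitarySpectral.PreservesRight X μ → μ ≪ circleLebesgue) ∧
    (μ ≠ 0 → μ ⟂ₘ circleLebesgue → UnitarySpectral.PreservesRight X μ → X = 1) := by
  refine ⟨UnitarySpectral.preservesRight_iff_preservesLeft X μ,
    fun hX1 hX => hX.absolutelyContinuous hH hX1, fun hμ hs hX => ?_⟩
  by_contra hX1
  exact hμ (Measure.eq_zero_of_absolutelyContinuous_of_mutuallySingular
    (hX.absolutelyContinuous hH hX1) hs)
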